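/- Work in second-order arithmetic. Inside $\mathsf{RCA}_0$, a quasi-order is a set $Q\subseteq\mathbb N$ with a set $\le_Q\,\subseteq Q\times Q$ that is a reflexive and transitive relation; a well-order is a quasi-order that is antisymmetric and total and has no infinite strictly descending sequence. $\mathcal P_{\mathrm f}(A)$ denotes the set of (codes of) finite subsets of $A$. For $A,B\subseteq Q$ write $A\le_Q^\flat B$ if $(\forall a\in A)(\exists b\in B)(a\le_Q b)$, and for $E\subseteq Q$ let $X\in\{E\}{\downarrow}^\flat$ abbreviate $X\subseteq Q\wedge X\le_Q^\flat E$. The space $\mathrm{upper}(\mathcal P^\flat(Q))$ has as points the sets $X\subseteq Q$ and as indices of basic open sets the elements $\mathbf i\in\mathcal P_{\mathrm f}(Q)$, where $X$ is in the basic open set with index $\mathbf i$ if and only if $(\forall q\in\mathbf i)(\exists x\in X)(q\le_Q x)$. A function $h\colon\mathbb N\to\mathcal P_{\mathrm f}(\mathcal P_{\mathrm f}(Q))$ codes the effectively closed set $F_h$ of all points $X$ that are in no basic open set with index $\mathbf i\in h(n)$, $n\in\mathbb N$. To say that $\{E\}{\downarrow}^\flat$ is effectively closed in $\mathrm{upper}(\mathcal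 P^\flat(Q))$ means that there is such an $h$ with $X\in\{E\}{\downarrow}^\flat\leftrightarrow X\in F_h$ for all $X\subseteq Q$. **Proposition 3.10.** The following are equivalent over $\mathsf{RCA}_0$ (equivalently, in every model of $\mathsf{RCA}_0$, not necessarily an $\omega$-model, they have the same truth value): (i) $\mathsf{ACA}_0$. (ii) If $Q$ is a quasi-order and $E\subseteq Q$, then $\{E\}{\downarrow}^\flat$ is effectively closed in $\mathrm{upper}(\mathcal P^\flat(Q))$. (iii) If $W$ is a well-order and $E\subseteq W$, then $\{E\}{\downarrow}^\flat$ is effectively closed in $\mathrm{upper}(\mathcal P^\flat(W))$. -/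

import Mathlib

universe u

namespace SecondOrderArith

/-! ### The language of second-order arithmetic -/

/-- Numerical terms, over number variables indexed by `ℕ`. -/
inductive NumTerm : Type
  | var (i : ℕ)
  | zero
  | one
  | add (s t : NumTerm)
  | mul (s t : NumTerm)

/-- The number variable `i` occurs in the term. -/
def NumTerm.Occurs (i : ℕ) : NumTerm → Prop
  | var j => i = j
  | zero => False
  | one => False
  | add s t => s.Occurs i ∨ t.Occurs i
  | mul s t => s.Occurs i ∨ t.Occurs i

/-- Formulas of second-order arithmetic: number variables and set variables are both indexed
by `ℕ`; `all`, `ex` bind number variables, `allSet`, `exSet` bind set variables. -/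
inductive Formula : Type
  | eq (s t : NumTerm)
  | lt (s t : NumTerm)
  | mem (t : NumTerm) (X : ℕ)
  | neg (φ : Formula)
  | and (φ ψ : Formula)
  | or (φ ψ : Formula)
  | imp (φ ψ : Formula)
  | all (i : ℕ) (φ : Formula)
  | ex (i : ℕ) (φ : Formula)
  | allSet (X : ℕ) (φ : Formula)
  | exSet (X : ℕ) (φ : Formula)

namespace Formula

/-- Bounded-quantifier formulas: all quantifiers have the form `∀ i < t` or `∃ i < t`, where
the number variable `i` does not occur in the term `t`; set parameters are allowed. -/
inductive IsBounded : Formula → Prop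
  | eq (s t : NumTerm) : IsBounded (eq s t)
  | lt (s t : NumTerm) : IsBounded (lt s t)
  | mem (t : NumTerm) (X : ℕ) : IsBounded (mem t X)
  | neg {φ : Formula} : IsBounded φ → IsBounded (neg φ)
  | and {φ ψ : Formula} : IsBounded φ → IsBounded ψ → IsBounded (and φ ψ)
  | or {φ ψ : Formula} : IsBounded φ → IsBounded ψ → IsBounded (or φ ψ)
  | imp {φ ψ : Formula} : IsBounded φ → IsBounded ψ → IsBounded (imp φ ψ)
  | ball {i : ℕ} {t : NumTerm} {φ : Formula} : ¬ t.Occurs i → IsBounded φ →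
      IsBounded (all i (imp (lt (NumTerm.var i) t) φ))
  | bex {i : ℕ} {t : NumTerm} {φ : Formula} : ¬ t.Occurs i → IsBounded φ →
      IsBounded (ex i (and (lt (NumTerm.var i) t) φ))

/-- `Σ⁰₁` formulas: one number quantifier `∃` in front of a bounded-quantifier formula. -/
def IsSigma01 (φ : Formula) : Prop := ∃ (i : ℕ) (θ : Formula), θ.IsBounded ∧ φ = ex i θ

/-- `Π⁰₁` formulas: one number quantifier `∀` in front of a bounded-quantifier formula. -/
def IsPi01 (φ : Formula) : Prop := ∃ (i : ℕ) (θ : Formula), θ.IsBounded ∧ φ = all i θ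

/-- Arithmetical formulas: those without set quantifiers (set parameters are allowed). -/
def IsArithmetical : Formula → Prop
  | eq _ _ => True
  | lt _ _ => True
  | mem _ _ => True
  | neg φ => φ.IsArithmetical
  | and φ ψ => φ.IsArithmetical ∧ ψ.IsArithmetical
  | or φ ψ => φ.IsArithmetical ∧ ψ.IsArithmetical
  | imp φ ψ => φ.IsArithmetical ∧ ψ.IsArithmetical
  | all _ φ => φ.IsArithmetical
  | ex _ φ => φ.IsArithmetical
  | allSet _ _ => False
  | exSet _ _ => False

end Formula

/-! ### Structures and satisfaction -/

/-- A (Henkin) structure for the language of second-order arithmetic: the number variables range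
over the nonempty domain `Num`, which may be nonstandard, and the set variables range over a
nonempty collection `sets` of subsets of `Num`, which need not contain all of them. -/
structure Model where
  Num : Type u
  zero : Num
  one : Num
  add : Num → Num → Num
  mul : Num → Num → Num
  lt : Num → Num → Prop
  sets : Set (Set Num)
  sets_nonempty : sets.Nonempty

/-- The value of a term under an assignment of the number variables. -/
def NumTerm.eval (M : Model.{u}) (ρ : ℕ → M.Num) : NumTerm → M.Num
  | var i => ρ i
  | zero => M.zero
  | one => M.one
  | add s t => M.add (s.eval M ρ) (t.eval M ρ)
  | mul s t => M.mul (s.eval M ρ) (t.eval M ρ)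

/-- Truth of a formula in `M` under assignments `ρ` of the number variables and `σ` of the set
variables; set quantifiers range over `M.sets`. -/
def Formula.Holds (M : Model.{u}) : Formula → (ℕ → M.Num) → (ℕ → M.sets) → Prop
  | eq s t, ρ, _ => s.eval M ρ = t.eval M ρ
  | lt s t, ρ, _ => M.lt (s.eval M ρ) (t.eval M ρ)
  | mem t X, ρ, σ => t.eval M ρ ∈ (σ X).1
  | neg φ, ρ, σ => ¬ φ.Holds M ρ σ
  | and φ ψ, ρ, σ => φ.Holds M ρ σ ∧ ψ.Holds M ρ σ
  | or φ ψ, ρ, σ => φ.Holds M ρ σ ∨ ψ.Holds M ρ σ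
  | imp φ ψ, ρ, σ => φ.Holds M ρ σ → ψ.Holds M ρ σ
  | all i φ, ρ, σ => ∀ a : M.Num, φ.Holds M (Function.update ρ i a) σ
  | ex i φ, ρ, σ => ∃ a : M.Num, φ.Holds M (Function.update ρ i a) σ
  | allSet X φ, ρ, σ => ∀ A : M.sets, φ.Holds M ρ (Function.update σ X A)
  | exSet X φ, ρ, σ => ∃ A : M.sets, φ.Holds M ρ (Function.update σ X A)

namespace Model

/-! ### The axiom systems -/

/-- The numbers of `M` form a discretely ordered commutative semiring with identity, with least
element `0`. -/
structure BasicAxioms (M : Model.{u}) : Prop where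
  add_assoc : ∀ a b c, M.add (M.add a b) c = M.add a (M.add b c)
  add_comm : ∀ a b, M.add a b = M.add b a
  add_zero : ∀ a, M.add a M.zero = a
  mul_assoc : ∀ a b c, M.mul (M.mul a b) c = M.mul a (M.mul b c)
  mul_comm : ∀ a b, M.mul a b = M.mul b a
  mul_one : ∀ a, M.mul a M.one = a
  mul_zero : ∀ a, M.mul a M.zero = M.zero
  mul_add : ∀ a b c, M.mul a (M.add b c) = M.add (M.mul a b) (M.mul a c)
  lt_irrefl : ∀ a, ¬ M.lt a a
  lt_trans : ∀ a b c, M.lt a b → M.lt b c → M.lt a c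
  lt_trichotomy : ∀ a b, M.lt a b ∨ a = b ∨ M.lt b a
  add_lt_add : ∀ a b c, M.lt a b → M.lt (M.add a c) (M.add b c)
  mul_lt_mul : ∀ a b c, M.lt M.zero c → M.lt a b → M.lt (M.mul a c) (M.mul b c)
  zero_lt_one : M.lt M.zero M.one
  not_lt_zero : ∀ a, ¬ M.lt a M.zero
  discrete : ∀ a, ¬ (M.lt M.zero a ∧ M.lt a M.one)

/-- Universal closure of `[φ(0) ∧ ∀ n (φ(n) → φ(n+1))] → ∀ n φ(n)`, where `n` is the number
variable `i`. -/
def InductionFor (M : Model.{u}) (φ : Formula) (i : ℕ) : Prop :=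
  ∀ (ρ : ℕ → M.Num) (σ : ℕ → M.sets),
    φ.Holds M (Function.update ρ i M.zero) σ →
    (∀ n, φ.Holds M (Function.update ρ i n) σ →
      φ.Holds M (Function.update ρ i (M.add n M.one)) σ) →
    ∀ n, φ.Holds M (Function.update ρ i n) σ

/-- The `Σ⁰₁` induction scheme. -/
def Sigma01Induction (M : Model.{u}) : Prop :=
  ∀ (φ : Formula) (i : ℕ), φ.IsSigma01 → M.InductionFor φ i

/-- The `Δ⁰₁` comprehension scheme (with parameters). -/
def Delta01Comprehension (M : Model.{u}) : Prop :=
  ∀ (φ ψ : Formula) (i : ℕ), φ.IsSigma01 → ψ.IsPi01 →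
    ∀ (ρ : ℕ → M.Num) (σ : ℕ → M.sets),
      (∀ n, φ.Holds M (Function.update ρ i n) σ ↔ ψ.Holds M (Function.update ρ i n) σ) →
      ∃ X ∈ M.sets, ∀ n, n ∈ X ↔ φ.Holds M (Function.update ρ i n) σ

/-- The induction axiom. -/
def InductionAxiom (M : Model.{u}) : Prop :=
  ∀ X ∈ M.sets, M.zero ∈ X → (∀ n, n ∈ X → M.add n M.one ∈ X) → ∀ n, n ∈ X

/-- The arithmetical comprehension scheme (with parameters). -/
def ArithmeticalComprehension (M : Model.{u}) : Prop :=
  ∀ (φ : Formula) (i : ℕ), φ.IsArithmetical →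
    ∀ (ρ : ℕ → M.Num) (σ : ℕ → M.sets),
      ∃ X ∈ M.sets, ∀ n, n ∈ X ↔ φ.Holds M (Function.update ρ i n) σ

/-- `M` is a model of `RCA₀`. -/
structure IsRCA0 (M : Model.{u}) : Prop where
  basic : M.BasicAxioms
  induction : M.Sigma01Induction
  comprehension : M.Delta01Comprehension

/-- `M` is a model of `ACA₀`. -/
structure IsACA0 (M : Model.{u}) : Prop where
  basic : M.BasicAxioms
  induction : M.InductionAxiom
  comprehension : M.ArithmeticalComprehension

/-! ### Coding of pairs, finite sets and functions, inside a model

All definitions below are formulas of second-order arithmetic interpreted in `M`: number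
quantifiers range over `M.Num`, and every set that is quantified over belongs to `M.sets`. -/

/-- The code `(a, b) = (a + b)² + a` of an ordered pair of numbers. -/
def pair (M : Model.{u}) (a b : M.Num) : M.Num :=
  M.add (M.mul (M.add a b) (M.add a b)) a

/-- `FinMem a c`: `c = ((k, m), n)` for some `k, m, n` such that `a < k` and `m(a+1)+1` divides
`n`. This is the membership relation `a ∈ c` for finite sets of numbers coded by numbers. -/
def FinMem (M : Model.{u}) (a c : M.Num) : Prop :=
  ∃ k m n, c = M.pair (M.pair k m) n ∧ M.lt a k ∧
    ∃ q, M.mul q (M.add (M.mul m (M.add a M.one)) M.one) = n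

/-- `c` is the code of a finite set: it is the least triple with its elements. -/
def IsFinCode (M : Model.{u}) (c : M.Num) : Prop :=
  (∃ k m n, c = M.pair (M.pair k m) n) ∧
    ∀ k m n, M.lt (M.pair (M.pair k m) n) c →
      ¬ ∀ a, M.FinMem a (M.pair (M.pair k m) n) ↔ M.FinMem a c

/-- `Pf A`: the (codes of) finite subsets of `A`. -/
def Pf (M : Model.{u}) (A : Set M.Num) : Set M.Num :=
  {c | M.IsFinCode c ∧ ∀ a, M.FinMem a c → a ∈ A}

/-- `F` (a set of pairs) is a function from `A` to `B`. -/
def IsFunction (M : Model.{u}) (F A B : Set M.Num) : Prop :=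
  (∀ z ∈ F, ∃ a ∈ A, ∃ b ∈ B, z = M.pair a b) ∧ ∀ a ∈ A, ∃! b, M.pair a b ∈ F

/-! ### Quasi-orders and well-orders in a model -/

/-- `(Q, R)` is a quasi-order in `M`: `Q` and `R` are sets of `M`, and `R ⊆ Q × Q` is a reflexive
and transitive relation on `Q`. The relation `p ≤ q` is `M.pair p q ∈ R`. -/
structure IsQuasiOrder (M : Model.{u}) (Q R : Set M.Num) : Prop where
  carrier_mem : Q ∈ M.sets
  rel_mem : R ∈ M.sets
  rel_subset : ∀ z ∈ R, ∃ p ∈ Q, ∃ q ∈ Q, z = M.pair p q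
  refl : ∀ q ∈ Q, M.pair q q ∈ R
  trans : ∀ p ∈ Q, ∀ q ∈ Q, ∀ r ∈ Q, M.pair p q ∈ R → M.pair q r ∈ R → M.pair p r ∈ R

/-- `(W, R)` is a well-order in `M`: a linear order without an infinite strictly descending
sequence in `M`. -/
structure IsWellOrder (M : Model.{u}) (W R : Set M.Num) : Prop extends M.IsQuasiOrder W R where
  antisymm : ∀ p ∈ W, ∀ q ∈ W, M.pair p q ∈ R → M.pair q p ∈ R → p = q
  total : ∀ p ∈ W, ∀ q ∈ W, M.pair p q ∈ R ∨ M.pair q p ∈ R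
  no_descending : ¬ ∃ f ∈ M.sets, M.IsFunction f Set.univ W ∧
    ∀ n a b, M.pair n a ∈ f → M.pair (M.add n M.one) b ∈ f →
      M.pair b a ∈ R ∧ M.pair a b ∉ R

/-! ### The upper topology on `P♭(Q)` -/

/-- `A ≤♭ B`: every element of `A` is below some element of `B`. -/
def FlatLE (M : Model.{u}) (R A B : Set M.Num) : Prop :=
  ∀ a ∈ A, ∃ b ∈ B, M.pair a b ∈ R

/-- The point `X ⊆ Q` lies in the basic open set of `upper(P♭(Q))` with index `i ∈ Pf Q`, that
is, `i ⊆ X↓`. -/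
def FlatInBasic (M : Model.{u}) (R X : Set M.Num) (i : M.Num) : Prop :=
  ∀ q, M.FinMem q i → ∃ x ∈ X, M.pair q x ∈ R

/-- The point `X ⊆ Q` lies in the effectively closed set `F_h` of `upper(P♭(Q))` coded by the
function `h : ℕ → Pf (Pf Q)`, that is, in no basic open set with index in some `h(n)`. -/
def FlatInClosed (M : Model.{u}) (R h X : Set M.Num) : Prop :=
  ∀ n c, M.pair n c ∈ h → ∀ i, M.FinMem i c → ¬ M.FlatInBasic R X i

/-- The downward closure `{E}↓♭` with respect to `≤♭` is effectively closed in `upper(P♭(Q))`: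
some code `h : ℕ → Pf (Pf Q)` in `M` satisfies `X ∈ {E}↓♭ ↔ X ∈ F_h` for all points `X`. -/
def PrincipalFlatClosed (M : Model.{u}) (Q R E : Set M.Num) : Prop :=
  ∃ h ∈ M.sets, M.IsFunction h Set.univ (M.Pf (M.Pf Q)) ∧
    ∀ X ∈ M.sets, X ⊆ Q → (M.FlatLE R X E ↔ M.FlatInClosed R h X)

/-- For every quasi-order `Q` and `E ⊆ Q`, `{E}↓♭` is effectively closed in `upper(P♭(Q))`. -/
def FlatClosedForQuasiOrders (M : Model.{u}) : Prop :=
  ∀ Q R E : Set M.Num, M.IsQuasiOrder Q R → E ∈ M.sets → E ⊆ Q → M.PrincipalFlatClosed Q R E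

/-- For every well-order `W` and `E ⊆ W`, `{E}↓♭` is effectively closed in `upper(P♭(W))`. -/
def FlatClosedForWellOrders (M : Model.{u}) : Prop :=
  ∀ W R E : Set M.Num, M.IsWellOrder W R → E ∈ M.sets → E ⊆ W → M.PrincipalFlatClosed W R E

end Model

end SecondOrderArith

set_option linter.unusedSectionVars false

namespace SecondOrderArith

/-! ### Injective renaming of variables -/

/-! From `ACA₀` to quasi-orders: the elements of `Q` below no element of `E` form a set `D`, which
is upward closed. Hence `X ≤♭ E` holds exactly when no element of `X` lies above an element of `D`,
and `h(n) = {{n}}` for `n ∈ D`, `h(n) = ∅` otherwise, is a code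
(`SigmaComprehension.flatClosedForQuasiOrders`). Well-orders are quasi-orders.

From well-orders to `ACA₀`: `Σ⁰₁` comprehension suffices (`SigmaComprehension.isACA0`). Suppose that
`A = {n | ∃ x, P n x}` is not a set of the model. The function `stageValue P` takes the value `n ∈
A` at the pair of `n` and its first witness, and is the identity at all other stages. A stage is
true if no smaller value comes later; any unbounded `Σ⁰₁` collection of true stages decides `A`
(`setOf_exists_mem_of_trueStages`). The order `StageLE` looks like `ω + ω*`: false stages have
finitely many predecessors, and the true stages lie above them in reversed order. A descending
sequence in the model would yield arbitrarily large true stages and so compute `A`; thus the model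
sees a well-order (`isWellOrder_stageRel`).

Let `E` consist of the stages whose successor has a smaller value. It is a set, and it is cofinal in
the false stages, so `s` is true exactly when `{s} ≤♭ E` fails (`trueStage_iff`). A code for the
closed set makes this failure `Σ⁰₁`. The true stages then decide `A`, a contradiction.

To apply the axiom schemes, definability is treated semantically by `IsTerm`, `IsBdd` and `IsSig`,
and `IsBdd.realize` leads back to formulas. -/

def NumTerm.rename (f : ℕ → ℕ) : NumTerm → NumTerm
  | var i => var (f i)
  | zero => zero
  | one => one
  | add s t => add (s.rename f) (t.rename f)
  | mul s t => mul (s.rename f) (t.rename f)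

theorem NumTerm.eval_rename (M : Model.{u}) (f : ℕ → ℕ) (ρ : ℕ → M.Num) (t : NumTerm) :
    (t.rename f).eval M ρ = t.eval M (ρ ∘ f) := by
  induction t <;> simp_all [NumTerm.rename, NumTerm.eval]

theorem NumTerm.occurs_rename {f : ℕ → ℕ} {i : ℕ} {t : NumTerm} :
    (t.rename f).Occurs i → ∃ j, f j = i ∧ t.Occurs j := by
  induction t with
  | var j => exact fun h => ⟨j, h.symm, rfl⟩
  | zero => exact False.elim
  | one => exact False.elim
  | add s t hs ht =>
    rintro (h | h)
    · obtain ⟨j, h1, h2⟩ := hs h; exact ⟨j, h1, Or.inl h2⟩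
    · obtain ⟨j, h1, h2⟩ := ht h; exact ⟨j, h1, Or.inr h2⟩
  | mul s t hs ht =>
    rintro (h | h)
    · obtain ⟨j, h1, h2⟩ := hs h; exact ⟨j, h1, Or.inl h2⟩
    · obtain ⟨j, h1, h2⟩ := ht h; exact ⟨j, h1, Or.inr h2⟩

def Formula.rename (f g : ℕ → ℕ) : Formula → Formula
  | eq s t => eq (s.rename f) (t.rename f)
  | lt s t => lt (s.rename f) (t.rename f)
  | mem t X => mem (t.rename f) (g X)
  | neg φ => neg (φ.rename f g)
  | and φ ψ => and (φ.rename f g) (ψ.rename f g)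
  | or φ ψ => or (φ.rename f g) (ψ.rename f g)
  | imp φ ψ => imp (φ.rename f g) (ψ.rename f g)
  | all i φ => all (f i) (φ.rename f g)
  | ex i φ => ex (f i) (φ.rename f g)
  | allSet X φ => allSet (g X) (φ.rename f g)
  | exSet X φ => exSet (g X) (φ.rename f g)

/-- Injectivity prevents capture: updating the renamed bound variable must not change any other
variable. -/
theorem Formula.holds_rename (M : Model.{u}) {f g : ℕ → ℕ} (hf : f.Injective) (hg : g.Injective)
    (φ : Formula) : ∀ (ρ : ℕ → M.Num) (σ : ℕ → M.sets),
    (φ.rename f g).Holds M ρ σ ↔ φ.Holds M (ρ ∘ f) (σ ∘ g) := by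
  induction φ <;> intro ρ σ <;>
    simp_all [Formula.rename, Formula.Holds, NumTerm.eval_rename,
      Function.update_comp_eq_of_injective]

theorem Formula.IsBounded.rename {f g : ℕ → ℕ} (hf : f.Injective) {φ : Formula}
    (h : φ.IsBounded) : (φ.rename f g).IsBounded := by
  have key : ∀ {i : ℕ} {t : NumTerm}, ¬ t.Occurs i → ¬ (t.rename f).Occurs (f i) := by
    intro i t hi h
    obtain ⟨j, h1, h2⟩ := NumTerm.occurs_rename h
    exact hi (hf h1 ▸ h2)
  induction h with
  | eq => exact .eq _ _
  | lt => exact .lt _ _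
  | mem => exact .mem _ _
  | neg _ h => exact .neg h
  | and _ _ h h' => exact .and h h'
  | or _ _ h h' => exact .or h h'
  | imp _ _ h h' => exact .imp h h'
  | ball hi _ h => exact .ball (key hi) h
  | bex hi _ h => exact .bex (key hi) h

namespace Model

/-! ### The ordered semiring of numbers -/

section Semiring

variable {M : Model.{u}} [hM : Fact M.IsRCA0]

instance : Zero M.Num := ⟨M.zero⟩
instance : One M.Num := ⟨M.one⟩
instance : Add M.Num := ⟨M.add⟩
instance : Mul M.Num := ⟨M.mul⟩
instance : LT M.Num := ⟨M.lt⟩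
instance : LE M.Num := ⟨fun a b => ¬ M.lt b a⟩

theorem basicAxioms : M.BasicAxioms := hM.out.basic

noncomputable instance : CommSemiring M.Num where
  add_assoc := basicAxioms.add_assoc
  zero_add a := (basicAxioms.add_comm _ _).trans (basicAxioms.add_zero a)
  add_zero := basicAxioms.add_zero
  add_comm := basicAxioms.add_comm
  nsmul := nsmulRec
  left_distrib := basicAxioms.mul_add
  right_distrib a b c := by
    change M.mul (M.add a b) c = M.add (M.mul a c) (M.mul b c)
    rw [basicAxioms.mul_comm, basicAxioms.mul_add, basicAxioms.mul_comm c, basicAxioms.mul_comm c]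
  zero_mul a := (basicAxioms.mul_comm _ _).trans (basicAxioms.mul_zero a)
  mul_zero := basicAxioms.mul_zero
  mul_assoc := basicAxioms.mul_assoc
  one_mul a := (basicAxioms.mul_comm _ _).trans (basicAxioms.mul_one a)
  mul_one := basicAxioms.mul_one
  mul_comm := basicAxioms.mul_comm

noncomputable instance : LinearOrder M.Num where
  le_refl := basicAxioms.lt_irrefl
  le_trans a b c hab hbc hca := by
    rcases basicAxioms.lt_trichotomy a b with h | h | h
    · exact hbc (basicAxioms.lt_trans _ _ _ hca h)
    · exact hbc (h ▸ hca)
    · exact hab h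
  le_antisymm a b hab hba := by
    rcases basicAxioms.lt_trichotomy a b with h | h | h
    · exact absurd h hba
    · exact h
    · exact absurd h hab
  lt_iff_le_not_ge a b := by
    refine ⟨fun h => ⟨fun h' => ?_, fun h' => h' h⟩, fun h => not_not.1 h.2⟩
    exact basicAxioms.lt_irrefl _ (basicAxioms.lt_trans _ _ _ h h')
  le_total a b := by
    by_contra h
    obtain ⟨h1, h2⟩ := not_or.1 h
    exact basicAxioms.lt_irrefl _ (basicAxioms.lt_trans _ _ _ (not_not.1 h1) (not_not.1 h2))
  toDecidableLE := Classical.decRel _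

theorem num_add_lt_add {a b : M.Num} (c : M.Num) (h : a < b) : a + c < b + c :=
  basicAxioms.add_lt_add _ _ _ h

instance : IsStrictOrderedRing M.Num where
  add_le_add_left a b h c := by
    rcases h.lt_or_eq with h | rfl
    · exact (num_add_lt_add c h).le
    · exact le_rfl
  le_of_add_le_add_left a b c h := by
    by_contra h'
    refine absurd h (not_le.2 ?_)
    rw [add_comm a, add_comm a]
    exact num_add_lt_add a (not_le.1 h')
  zero_le_one := le_of_lt basicAxioms.zero_lt_one
  exists_pair_ne := ⟨0, 1, ne_of_lt basicAxioms.zero_lt_one⟩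
  mul_lt_mul_of_pos_left a ha b c hbc := by
    change a * b < a * c
    rw [mul_comm a, mul_comm a]
    exact basicAxioms.mul_lt_mul _ _ _ ha hbc
  mul_lt_mul_of_pos_right a ha b c hbc := basicAxioms.mul_lt_mul _ _ _ ha hbc

theorem num_zero_le (a : M.Num) : 0 ≤ a := basicAxioms.not_lt_zero a

theorem pair_eq (a b : M.Num) : M.pair a b = (a + b) * (a + b) + a := rfl

end Semiring

/-! ### Bounded definability with parameters -/

section Definability

variable (M : Model.{u}) [hM : Fact M.IsRCA0]

/-- The functions of an assignment of number variables given by terms with parameters. -/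
inductive IsTerm : ((ℕ → M.Num) → M.Num) → Prop
  | var (i : ℕ) : IsTerm fun v => v i
  | const (a : M.Num) : IsTerm fun _ => a
  | add {f g} : IsTerm f → IsTerm g → IsTerm fun v => f v + g v
  | mul {f g} : IsTerm f → IsTerm g → IsTerm fun v => f v * g v

/-- The properties of an assignment of number variables given by bounded-quantifier formulas with
parameters. -/
inductive IsBdd : ((ℕ → M.Num) → Prop) → Prop
  | eq {f g} : M.IsTerm f → M.IsTerm g → IsBdd fun v => f v = g v
  | lt {f g} : M.IsTerm f → M.IsTerm g → IsBdd fun v => f v < g v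
  | mem {A f} : A ∈ M.sets → M.IsTerm f → IsBdd fun v => f v ∈ A
  | neg {P} : IsBdd P → IsBdd fun v => ¬ P v
  | and {P Q} : IsBdd P → IsBdd Q → IsBdd fun v => P v ∧ Q v
  | or {P Q} : IsBdd P → IsBdd Q → IsBdd fun v => P v ∨ Q v
  | imp {P Q} : IsBdd P → IsBdd Q → IsBdd fun v => P v → Q v
  | ball {f} {P : (ℕ → M.Num) → M.Num → Prop} : M.IsTerm f →
      IsBdd (fun w => P (fun i => w (i + 1)) (w 0)) → IsBdd fun v => ∀ a, a < f v → P v a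
  | bex {f} {P : (ℕ → M.Num) → M.Num → Prop} : M.IsTerm f →
      IsBdd (fun w => P (fun i => w (i + 1)) (w 0)) → IsBdd fun v => ∃ a, a < f v ∧ P v a

/-- Extend an assignment by a value for a new variable `0`. -/
def cons {α : Type*} (a : α) (v : ℕ → α) : ℕ → α
  | 0 => a
  | n + 1 => v n

/-- `v` on the even and `ρ` on the odd indices. -/
def interleave {α : Type*} (v ρ : ℕ → α) (n : ℕ) : α :=
  if n % 2 = 0 then v (n / 2) else ρ (n / 2)

theorem interleave_even {α : Type*} (v ρ : ℕ → α) (i : ℕ) : interleave v ρ (2 * i) = v i := by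
  simp [interleave]

theorem interleave_odd {α : Type*} (v ρ : ℕ → α) (i : ℕ) :
    interleave v ρ (2 * i + 1) = ρ i := by
  have h : (2 * i + 1) / 2 = i := by omega
  simp [interleave, h]

/-- Moves the odd index `2 * i + 1` to `4 * i + 3` and fixes the even indices. -/
def leftRen (n : ℕ) : ℕ := if n % 2 = 0 then n else 2 * n + 1

/-- Moves the odd index `2 * i + 1` to `4 * i + 5` and fixes the even indices. -/
def rightRen (n : ℕ) : ℕ := if n % 2 = 0 then n else 2 * n + 3

/-- Moves the odd indices as `rightRen`, the index `0` to `1`, and shifts the other even indices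
down. -/
def shiftRen (n : ℕ) : ℕ := if n = 0 then 1 else if n % 2 = 0 then n - 2 else 2 * n + 3

theorem leftRen_injective : leftRen.Injective := by
  intro a b h; unfold leftRen at h; split_ifs at h <;> omega

theorem rightRen_injective : rightRen.Injective := by
  intro a b h; unfold rightRen at h; split_ifs at h <;> omega

theorem shiftRen_injective : shiftRen.Injective := by
  intro a b h; unfold shiftRen at h; split_ifs at h <;> omega

theorem even_injective : (fun i : ℕ => 2 * i).Injective := by intro a b h; simpa using h

theorem odd_injective : (fun i : ℕ => 2 * i + 1).Injective := by intro a b h; simpa using h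

/-- Parameters `ρ` at the slots `2 * i + 1` and `τ` at the slots `2 * i + 2`. -/
def joinParams {α : Type*} (ρ τ : ℕ → α) : ℕ → α := cons (ρ 0) (interleave ρ τ)

theorem interleave_leftRen {α : Type*} (v ρ τ : ℕ → α) :
    interleave v (joinParams ρ τ) ∘ leftRen = interleave v ρ := by
  funext n
  obtain ⟨i, rfl | rfl⟩ := Nat.even_or_odd' n
  · simp [leftRen, interleave_even]
  · have h : leftRen (2 * i + 1) = 2 * (2 * i + 1) + 1 := by unfold leftRen; split_ifs <;> omega
    simp only [Function.comp, h, interleave_odd]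
    simp [joinParams, cons, interleave_even]

theorem interleave_rightRen {α : Type*} (v ρ τ : ℕ → α) :
    interleave v (joinParams ρ τ) ∘ rightRen = interleave v τ := by
  funext n
  obtain ⟨i, rfl | rfl⟩ := Nat.even_or_odd' n
  · simp [rightRen, interleave_even]
  · have h : rightRen (2 * i + 1) = 2 * (2 * i + 2) + 1 := by
      unfold rightRen; split_ifs <;> omega
    simp only [Function.comp, h, interleave_odd]
    simp [joinParams, cons, interleave_odd]

/-- The newest variable moves to slot `1`, which `leftRen`, `rightRen` and the parameters never use;
the value `ρ 0` that `joinParams` leaves there is a filler. -/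
theorem update_interleave_shiftRen {α : Type*} (v ρ τ : ℕ → α) (a : α) :
    Function.update (interleave v (joinParams ρ τ)) 1 a ∘ shiftRen =
      interleave (cons a v) τ := by
  funext n
  obtain ⟨i, rfl | rfl⟩ := Nat.even_or_odd' n
  · rw [interleave_even]
    cases i with
    | zero => simp [shiftRen, cons]
    | succ i =>
      have h : shiftRen (2 * (i + 1)) = 2 * i := by
        rw [shiftRen, if_neg (by omega), if_pos (by omega)]; omega
      simp only [Function.comp, h, cons]
      rw [Function.update_of_ne (by omega), interleave_even]
  · have h : shiftRen (2 * i + 1) = 2 * (2 * i + 2) + 1 := by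
      rw [shiftRen, if_neg (by omega), if_neg (by omega)]; omega
    simp only [Function.comp, h, interleave_odd]
    rw [Function.update_of_ne (by omega), interleave_odd]
    simp [joinParams, cons, interleave_odd]

theorem interleave_comp_even {α : Type*} (v ρ : ℕ → α) :
    interleave v ρ ∘ (fun i => 2 * i) = v := funext fun i => interleave_even v ρ i

theorem interleave_comp_odd {α : Type*} (v ρ : ℕ → α) :
    interleave v ρ ∘ (fun i => 2 * i + 1) = ρ := funext fun i => interleave_odd v ρ i

variable {M}

theorem IsTerm.realize {f : (ℕ → M.Num) → M.Num} (h : M.IsTerm f) :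
    ∃ (t : NumTerm) (ρ : ℕ → M.Num), ∀ v, t.eval M (interleave v ρ) = f v := by
  -- Both terms keep the even slots in common, while their parameters are moved to disjoint odd
  -- slots.
  have two : ∀ {f g : (ℕ → M.Num) → M.Num},
      (∃ (t : NumTerm) (ρ : ℕ → M.Num), ∀ v, t.eval M (interleave v ρ) = f v) →
      (∃ (t : NumTerm) (ρ : ℕ → M.Num), ∀ v, t.eval M (interleave v ρ) = g v) →
      ∃ (s t : NumTerm) (ρ : ℕ → M.Num), ∀ v, s.eval M (interleave v ρ) = f v ∧
        t.eval M (interleave v ρ) = g v := by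
    rintro f g ⟨s, ρ, hs⟩ ⟨t, τ, ht⟩
    refine ⟨s.rename leftRen, t.rename rightRen, joinParams ρ τ, fun v => ?_⟩
    simp only [NumTerm.eval_rename, interleave_leftRen, interleave_rightRen, hs, ht, and_self]
  induction h with
  | var i => exact ⟨.var (2 * i), fun _ => 0, fun v => interleave_even v _ i⟩
  | const a => exact ⟨.var 1, fun _ => a, fun v => interleave_odd v _ 0⟩
  | add _ _ hf hg =>
    obtain ⟨s, t, ρ, h⟩ := two hf hg
    exact ⟨.add s t, ρ, fun v => congrArg₂ M.add (h v).1 (h v).2⟩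
  | mul _ _ hf hg =>
    obtain ⟨s, t, ρ, h⟩ := two hf hg
    exact ⟨.mul s t, ρ, fun v => congrArg₂ M.mul (h v).1 (h v).2⟩

/-- Some bounded-quantifier formula with parameters defines `P`. -/
def BddRealizable (P : (ℕ → M.Num) → Prop) : Prop :=
  ∃ (θ : Formula) (ρ : ℕ → M.Num) (σ : ℕ → M.sets), θ.IsBounded ∧
    ∀ v, θ.Holds M (interleave v ρ) σ ↔ P v

theorem BddRealizable.two {P Q : (ℕ → M.Num) → Prop} (hP : BddRealizable P)
    (hQ : BddRealizable Q) :
    ∃ (θ η : Formula) (ρ : ℕ → M.Num) (σ : ℕ → M.sets), θ.IsBounded ∧ η.IsBounded ∧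
      ∀ v, (θ.Holds M (interleave v ρ) σ ↔ P v) ∧ (η.Holds M (interleave v ρ) σ ↔ Q v) := by
  obtain ⟨θ, ρ, σ, hθ, h⟩ := hP
  obtain ⟨η, τ, σ', hη, h'⟩ := hQ
  refine ⟨θ.rename leftRen fun i => 2 * i, η.rename rightRen fun i => 2 * i + 1,
    joinParams ρ τ, interleave σ σ', hθ.rename leftRen_injective, hη.rename rightRen_injective,
    fun v => ?_⟩
  rw [Formula.holds_rename M leftRen_injective even_injective,
    Formula.holds_rename M rightRen_injective odd_injective, interleave_leftRen,
    interleave_rightRen, interleave_comp_even, interleave_comp_odd]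
  exact ⟨h v, h' v⟩

/-- A term bound and a formula with an additional variable, in one assignment in which the index
`1` is free to be quantified. -/
theorem BddRealizable.quantifier {f : (ℕ → M.Num) → M.Num} {P : (ℕ → M.Num) → M.Num → Prop}
    (hf : M.IsTerm f) (hP : BddRealizable fun w : ℕ → M.Num => P (fun i => w (i + 1)) (w 0)) :
    ∃ (t : NumTerm) (θ : Formula) (ρ : ℕ → M.Num) (σ : ℕ → M.sets), ¬ t.Occurs 1 ∧
      θ.IsBounded ∧ ∀ v a, (t.eval M (Function.update (interleave v ρ) 1 a) = f v) ∧
        (θ.Holds M (Function.update (interleave v ρ) 1 a) σ ↔ P v a) := by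
  obtain ⟨t, ρ, ht⟩ := hf.realize
  obtain ⟨θ, τ, σ, hθ, h⟩ := hP
  have h1 : ∀ j, leftRen j ≠ 1 := by intro j; unfold leftRen; split_ifs <;> omega
  refine ⟨t.rename leftRen, θ.rename shiftRen id, joinParams ρ τ, σ, fun ho => ?_,
    hθ.rename shiftRen_injective, fun v a => ⟨?_, ?_⟩⟩
  · obtain ⟨j, hj, -⟩ := NumTerm.occurs_rename ho
    exact h1 j hj
  · rw [NumTerm.eval_rename, ← ht v, ← interleave_leftRen v ρ τ]
    congr 1
    funext j
    exact Function.update_of_ne (h1 j) _ _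
  · rw [Formula.holds_rename M shiftRen_injective Function.injective_id,
      update_interleave_shiftRen, Function.comp_id, h]
    rfl

theorem IsBdd.realize {P : (ℕ → M.Num) → Prop} (h : M.IsBdd P) : BddRealizable P := by
  -- Filler for the set assignment of atomic formulas without a set parameter.
  obtain ⟨A₀, hA₀⟩ := M.sets_nonempty
  have two : ∀ {f g : (ℕ → M.Num) → M.Num}, M.IsTerm f → M.IsTerm g →
      ∃ (s t : NumTerm) (ρ : ℕ → M.Num), ∀ v, s.eval M (interleave v ρ) = f v ∧
        t.eval M (interleave v ρ) = g v := by
    intro f g hf hg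
    obtain ⟨s, ρ, hs⟩ := hf.realize
    obtain ⟨t, τ, ht⟩ := hg.realize
    refine ⟨s.rename leftRen, t.rename rightRen, joinParams ρ τ, fun v => ?_⟩
    simp only [NumTerm.eval_rename, interleave_leftRen, interleave_rightRen, hs, ht, and_self]
  induction h with
  | eq hf hg =>
    obtain ⟨s, t, ρ, h⟩ := two hf hg
    exact ⟨.eq s t, ρ, fun _ => ⟨A₀, hA₀⟩, .eq _ _, fun v => by
      simp [Formula.Holds, (h v).1, (h v).2]⟩
  | lt hf hg =>
    obtain ⟨s, t, ρ, h⟩ := two hf hg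
    exact ⟨.lt s t, ρ, fun _ => ⟨A₀, hA₀⟩, .lt _ _, fun v => by
      rw [Formula.Holds, (h v).1, (h v).2]; rfl⟩
  | mem hA hf =>
    obtain ⟨t, ρ, h⟩ := hf.realize
    exact ⟨.mem t 0, ρ, fun _ => ⟨_, hA⟩, .mem _ _, fun v => by rw [Formula.Holds, h v]⟩
  | neg _ h =>
    obtain ⟨θ, ρ, σ, hθ, h⟩ := h
    exact ⟨.neg θ, ρ, σ, .neg hθ, fun v => not_congr (h v)⟩
  | and _ _ h h' =>
    obtain ⟨θ, η, ρ, σ, hθ, hη, h⟩ := h.two h'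
    exact ⟨.and θ η, ρ, σ, .and hθ hη, fun v => and_congr (h v).1 (h v).2⟩
  | or _ _ h h' =>
    obtain ⟨θ, η, ρ, σ, hθ, hη, h⟩ := h.two h'
    exact ⟨.or θ η, ρ, σ, .or hθ hη, fun v => or_congr (h v).1 (h v).2⟩
  | imp _ _ h h' =>
    obtain ⟨θ, η, ρ, σ, hθ, hη, h⟩ := h.two h'
    exact ⟨.imp θ η, ρ, σ, .imp hθ hη, fun v => imp_congr (h v).1 (h v).2⟩
  | ball hf _ h =>
    obtain ⟨t, θ, ρ, σ, ht, hθ, h⟩ := BddRealizable.quantifier hf h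
    refine ⟨_, ρ, σ, .ball ht hθ, fun v => forall_congr' fun a => ?_⟩
    rw [Formula.Holds, Formula.Holds, (h v a).1, (h v a).2, NumTerm.eval, Function.update_self]
    rfl
  | bex hf _ h =>
    obtain ⟨t, θ, ρ, σ, ht, hθ, h⟩ := BddRealizable.quantifier hf h
    refine ⟨_, ρ, σ, .bex ht hθ, fun v => exists_congr fun a => ?_⟩
    rw [Formula.Holds, Formula.Holds, (h v a).1, (h v a).2, NumTerm.eval, Function.update_self]
    rfl

/-! ### Substitution and finite dependency -/

theorem IsTerm.subst {f : (ℕ → M.Num) → M.Num} (hf : M.IsTerm f)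
    {τ : (ℕ → M.Num) → ℕ → M.Num} (hτ : ∀ i, M.IsTerm fun v => τ v i) :
    M.IsTerm fun v => f (τ v) := by
  induction hf with
  | var i => exact hτ i
  | const a => exact .const a
  | add _ _ h h' => exact .add h h'
  | mul _ _ h h' => exact .mul h h'

theorem IsTerm.shift {f : (ℕ → M.Num) → M.Num} (hf : M.IsTerm f) :
    M.IsTerm fun w => f fun i => w (i + 1) :=
  hf.subst fun i => .var (i + 1)

theorem isTerm_cons {τ : (ℕ → M.Num) → ℕ → M.Num} {f : (ℕ → M.Num) → M.Num} (hf : M.IsTerm f)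
    (hτ : ∀ i, M.IsTerm fun v => τ v i) (i : ℕ) : M.IsTerm fun v => cons (f v) (τ v) i := by
  cases i with
  | zero => exact hf
  | succ i => exact hτ i

/-- The substitution is quantified after the induction hypothesis is formed, because below a
quantifier it is extended by the new variable. -/
theorem IsBdd.subst {P : (ℕ → M.Num) → Prop} (hP : M.IsBdd P) :
    ∀ {τ : (ℕ → M.Num) → ℕ → M.Num}, (∀ i, M.IsTerm fun v => τ v i) →
    M.IsBdd fun v => P (τ v) := by
  induction hP with
  | eq hf hg => exact fun hτ => .eq (hf.subst hτ) (hg.subst hτ)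
  | lt hf hg => exact fun hτ => .lt (hf.subst hτ) (hg.subst hτ)
  | mem hA hf => exact fun hτ => .mem hA (hf.subst hτ)
  | neg _ h => exact fun hτ => .neg (h hτ)
  | and _ _ h h' => exact fun hτ => .and (h hτ) (h' hτ)
  | or _ _ h h' => exact fun hτ => .or (h hτ) (h' hτ)
  | imp _ _ h h' => exact fun hτ => .imp (h hτ) (h' hτ)
  | @ball f P hf _ h =>
    exact fun {τ} hτ => .ball (P := fun v => P (τ v)) (hf.subst hτ)
      (h (isTerm_cons (.var 0) fun i => (hτ i).shift))
  | @bex f P hf _ h =>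
    exact fun {τ} hτ => .bex (P := fun v => P (τ v)) (hf.subst hτ)
      (h (isTerm_cons (.var 0) fun i => (hτ i).shift))

theorem IsTerm.exists_support {f : (ℕ → M.Num) → M.Num} (hf : M.IsTerm f) :
    ∃ n, ∀ v v' : ℕ → M.Num, (∀ i < n, v i = v' i) → f v = f v' := by
  induction hf with
  | var i => exact ⟨i + 1, fun v v' h => h i i.lt_succ_self⟩
  | const a => exact ⟨0, fun v v' h => rfl⟩
  | add _ _ h h' =>
    obtain ⟨n, hn⟩ := h
    obtain ⟨m, hm⟩ := h'
    exact ⟨max n m, fun v v' h => by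
      beta_reduce
      rw [hn v v' fun i hi => h i (by omega), hm v v' fun i hi => h i (by omega)]⟩
  | mul _ _ h h' =>
    obtain ⟨n, hn⟩ := h
    obtain ⟨m, hm⟩ := h'
    exact ⟨max n m, fun v v' h => by
      beta_reduce
      rw [hn v v' fun i hi => h i (by omega), hm v v' fun i hi => h i (by omega)]⟩

/-- Finite support allows the relevant variables to be packed into a single number by iterated
pairing, as is needed to replace an unbounded quantifier by a set. -/
theorem IsBdd.exists_support {P : (ℕ → M.Num) → Prop} (hP : M.IsBdd P) :
    ∃ n, ∀ v v' : ℕ → M.Num, (∀ i < n, v i = v' i) → (P v ↔ P v') := by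
  have quant : ∀ {f : (ℕ → M.Num) → M.Num} {P : (ℕ → M.Num) → M.Num → Prop}, M.IsTerm f →
      (∃ n, ∀ w w' : ℕ → M.Num, (∀ i < n, w i = w' i) →
        (P (fun i => w (i + 1)) (w 0) ↔ P (fun i => w' (i + 1)) (w' 0))) →
      ∃ n, ∀ v v' : ℕ → M.Num, (∀ i < n, v i = v' i) → f v = f v' ∧ ∀ a, P v a ↔ P v' a := by
    rintro f P hf ⟨n, hn⟩
    obtain ⟨m, hm⟩ := hf.exists_support
    refine ⟨max n m, fun v v' h => ⟨hm v v' fun i hi => h i (by omega), fun a => ?_⟩⟩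
    refine hn (cons a v) (cons a v') fun i hi => ?_
    cases i with
    | zero => rfl
    | succ i => exact h i (by omega)
  induction hP with
  | eq hf hg =>
    obtain ⟨n, hn⟩ := hf.exists_support
    obtain ⟨m, hm⟩ := hg.exists_support
    exact ⟨max n m, fun v v' h => by
      beta_reduce
      rw [hn v v' fun i hi => h i (by omega), hm v v' fun i hi => h i (by omega)]⟩
  | lt hf hg =>
    obtain ⟨n, hn⟩ := hf.exists_support
    obtain ⟨m, hm⟩ := hg.exists_support
    exact ⟨max n m, fun v v' h => by
      beta_reduce
      rw [hn v v' fun i hi => h i (by omega), hm v v' fun i hi => h i (by omega)]⟩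
  | mem hA hf =>
    obtain ⟨n, hn⟩ := hf.exists_support
    exact ⟨n, fun v v' h => by beta_reduce; rw [hn v v' h]⟩
  | neg _ h =>
    obtain ⟨n, hn⟩ := h
    exact ⟨n, fun v v' h => not_congr (hn v v' h)⟩
  | and _ _ h h' =>
    obtain ⟨n, hn⟩ := h
    obtain ⟨m, hm⟩ := h'
    exact ⟨max n m, fun v v' h => by
      beta_reduce
      rw [hn v v' fun i hi => h i (by omega), hm v v' fun i hi => h i (by omega)]⟩
  | or _ _ h h' =>
    obtain ⟨n, hn⟩ := h
    obtain ⟨m, hm⟩ := h'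
    exact ⟨max n m, fun v v' h => by
      beta_reduce
      rw [hn v v' fun i hi => h i (by omega), hm v v' fun i hi => h i (by omega)]⟩
  | imp _ _ h h' =>
    obtain ⟨n, hn⟩ := h
    obtain ⟨m, hm⟩ := h'
    exact ⟨max n m, fun v v' h => by
      beta_reduce
      rw [hn v v' fun i hi => h i (by omega), hm v v' fun i hi => h i (by omega)]⟩
  | ball hf _ h =>
    obtain ⟨n, hn⟩ := quant hf h
    exact ⟨n, fun v v' h => by simp only [(hn v v' h).1, (hn v v' h).2]⟩
  | bex hf _ h =>
    obtain ⟨n, hn⟩ := quant hf h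
    exact ⟨n, fun v v' h => by simp only [(hn v v' h).1, (hn v v' h).2]⟩

end Definability

section Sigma

variable {M : Model.{u}} [hM : Fact M.IsRCA0]

/-! ### Further closure properties of bounded definability -/

theorem IsTerm.pair {f g : (ℕ → M.Num) → M.Num} (hf : M.IsTerm f) (hg : M.IsTerm g) :
    M.IsTerm fun v => M.pair (f v) (g v) :=
  ((hf.add hg).mul (hf.add hg)).add hf

theorem IsBdd.congr {P Q : (ℕ → M.Num) → Prop} (hP : M.IsBdd P) (h : ∀ v, P v ↔ Q v) :
    M.IsBdd Q := by
  rwa [← funext fun v => propext (h v)]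

theorem IsBdd.le {f g : (ℕ → M.Num) → M.Num} (hf : M.IsTerm f) (hg : M.IsTerm g) :
    M.IsBdd fun v => f v ≤ g v :=
  (IsBdd.lt hg hf).neg.congr fun _ => not_lt

theorem IsBdd.iff {P Q : (ℕ → M.Num) → Prop} (hP : M.IsBdd P) (hQ : M.IsBdd Q) :
    M.IsBdd fun v => P v ↔ Q v :=
  ((hP.imp hQ).and (hQ.imp hP)).congr fun _ => iff_def.symm

theorem IsBdd.const (p : Prop) : M.IsBdd fun _ => p := by
  have h : M.IsBdd fun _ => (0 : M.Num) = 0 := .eq (.const 0) (.const 0)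
  by_cases hp : p
  · exact h.congr fun _ => by simp [hp]
  · exact h.neg.congr fun _ => by simp [hp]

/-- Substitution of a term for the variable `0`, of which the assignment is extended. -/
theorem IsBdd.subst_cons {P : (ℕ → M.Num) → M.Num → Prop}
    (hP : M.IsBdd fun w => P (fun i => w (i + 1)) (w 0)) {τ : (ℕ → M.Num) → ℕ → M.Num}
    {f : (ℕ → M.Num) → M.Num} (hf : M.IsTerm f) (hτ : ∀ i, M.IsTerm fun v => τ v i) :
    M.IsBdd fun v => P (τ v) (f v) :=
  hP.subst (τ := fun v => cons (f v) (τ v)) (isTerm_cons hf hτ)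

/-! ### `Σ⁰₁` definability, induction and comprehension -/

variable (M) in
/-- The properties of an assignment of number variables given by `Σ⁰₁` formulas with
parameters. -/
def IsSig (P : (ℕ → M.Num) → Prop) : Prop :=
  ∃ Q : (ℕ → M.Num) → M.Num → Prop, M.IsBdd (fun w => Q (fun i => w (i + 1)) (w 0)) ∧
    ∀ v, P v ↔ ∃ x, Q v x

theorem update_interleave {α : Type*} (v ρ : ℕ → α) (i : ℕ) (a : α) :
    Function.update (interleave v ρ) (2 * i) a = interleave (Function.update v i a) ρ := by
  funext n
  obtain ⟨j, rfl | rfl⟩ := Nat.even_or_odd' n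
  · rw [interleave_even]
    by_cases h : j = i
    · subst h; simp
    · rw [Function.update_of_ne (by omega), Function.update_of_ne h, interleave_even]
  · rw [interleave_odd, Function.update_of_ne (by omega), interleave_odd]

/-- `Δ⁰₁` comprehension needs both formulas under one assignment. The witness is variable `0`, so
`n` is variable `1`, which sits at the even slot `2`. -/
theorem IsSig.realize_two {P P' : M.Num → Prop} (hP : M.IsSig fun v => P (v 0))
    (hP' : M.IsSig fun v => P' (v 0)) :
    ∃ (θ η : Formula) (ρ : ℕ → M.Num) (σ : ℕ → M.sets), θ.IsBounded ∧ η.IsBounded ∧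
      ∀ n, ((Formula.ex 0 θ).Holds M (Function.update ρ 2 n) σ ↔ P n) ∧
        ((Formula.ex 0 η).Holds M (Function.update ρ 2 n) σ ↔ P' n) := by
  obtain ⟨Q, hQ, h⟩ := hP
  obtain ⟨Q', hQ', h'⟩ := hP'
  obtain ⟨θ, η, ρ, σ, hθ, hη, hh⟩ := hQ.realize.two hQ'.realize
  refine ⟨θ, η, interleave (fun _ => 0) ρ, σ, hθ, hη, fun n => ?_⟩
  have e : ∀ x, Function.update (Function.update (interleave (fun _ => 0) ρ) 2 n) 0 x =
      interleave (Function.update (Function.update (fun _ => 0) 1 n) 0 x) ρ := by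
    intro x
    rw [← update_interleave, ← update_interleave]
  have e' : ∀ x : M.Num, (fun i => (Function.update (Function.update (fun _ => 0) 1 n) 0 x :
      ℕ → M.Num) (i + 1)) = fun i => (Function.update (fun _ => 0) 1 n : ℕ → M.Num) (i + 1) := by
    intro x
    funext i
    exact Function.update_of_ne (by omega) _ _
  constructor
  · rw [Formula.Holds]
    simp only [e, (hh _).1, e', Function.update_self]
    rw [← h]
    simp
  · rw [Formula.Holds]
    simp only [e, (hh _).2, e', Function.update_self]
    rw [← h']
    simp

theorem sigma_induction {P : M.Num → Prop} (hP : M.IsSig fun v => P (v 0)) (h0 : P 0)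
    (hs : ∀ n, P n → P (n + 1)) (n : M.Num) : P n := by
  obtain ⟨θ, _, ρ, σ, hθ, _, h⟩ := IsSig.realize_two hP hP
  exact (h n).1.1 (hM.out.induction _ 2 ⟨0, θ, hθ, rfl⟩ ρ σ ((h _).1.2 h0)
    (fun n hn => (h _).1.2 (hs n ((h n).1.1 hn))) n)

theorem delta_comprehension {P : M.Num → Prop} (hP : M.IsSig fun v => P (v 0))
    (hP' : M.IsSig fun v => ¬ P (v 0)) : {n | P n} ∈ M.sets := by
  obtain ⟨θ, η, ρ, σ, hθ, hη, h⟩ := IsSig.realize_two (P' := fun n => ¬ P n) hP hP'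
  obtain ⟨X, hX, hXP⟩ := hM.out.comprehension _ (.all 0 (.neg η)) 2 ⟨0, θ, hθ, rfl⟩
    ⟨0, _, .neg hη, rfl⟩ ρ σ fun n => by
      rw [(h n).1, ← not_iff_not, ← (h n).2]
      simp [Formula.Holds]
  have : {n | P n} = X := Set.ext fun n => ((hXP n).trans (h n).1).symm
  rwa [this]

theorem IsBdd.sig {P : (ℕ → M.Num) → Prop} (hP : M.IsBdd P) : M.IsSig P :=
  ⟨fun v _ => P v, hP.subst fun i => .var (i + 1), fun _ => (exists_const _).symm⟩

theorem bdd_comprehension {P : M.Num → Prop} (hP : M.IsBdd fun v => P (v 0)) :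
    {n | P n} ∈ M.sets :=
  delta_comprehension hP.sig hP.neg.sig

theorem bdd_induction {P : M.Num → Prop} (hP : M.IsBdd fun v => P (v 0)) (h0 : P 0)
    (hs : ∀ n, P n → P (n + 1)) (n : M.Num) : P n :=
  sigma_induction hP.sig h0 hs n

/-! ### Subtraction and discreteness -/

theorem eq_zero_or_eq_add_one (a : M.Num) : a = 0 ∨ ∃ b, a = b + 1 := by
  refine sigma_induction (P := fun a => a = 0 ∨ ∃ b, a = b + 1)
    ⟨fun v x => v 0 = 0 ∨ v 0 = x + 1, .or (.eq (.var 1) (.const 0))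
      (.eq (.var 1) (.add (.var 0) (.const 1))), fun v => ?_⟩ (Or.inl rfl)
    (fun n _ => Or.inr ⟨n, rfl⟩) a
  rw [exists_or, exists_const]

theorem num_lt_add_one (a : M.Num) : a < a + 1 := lt_add_of_pos_right a zero_lt_one

/-- The basic axioms do not include subtraction; it comes from `Σ⁰₁` induction on `a` with `b`
fixed. -/
theorem num_exists_add (a b : M.Num) : b < a ∨ ∃ c, b = a + c := by
  refine sigma_induction (P := fun a => b < a ∨ ∃ c, b = a + c)
    ⟨fun v x => b < v 0 ∨ b = v 0 + x, .or (.lt (.const b) (.var 1))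
      (.eq (.const b) (.add (.var 1) (.var 0))), fun v => ?_⟩ (Or.inr ⟨b, (zero_add b).symm⟩)
    (fun a ha => ?_) a
  · rw [exists_or, exists_const]
  · rcases ha with h | ⟨c, rfl⟩
    · exact Or.inl (h.trans (num_lt_add_one a))
    · obtain rfl | ⟨d, rfl⟩ := eq_zero_or_eq_add_one c
      · exact Or.inl (by simp)
      · exact Or.inr ⟨d, by ring⟩

instance : CanonicallyOrderedAdd M.Num where
  exists_add_of_le {a b} h := (num_exists_add a b).resolve_left h.not_gt
  le_add_self a b := by simpa using add_le_add_left (num_zero_le b) a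
  le_self_add a b := by simpa using add_le_add_right (num_zero_le b) a

theorem num_lt_add_one_iff {a b : M.Num} : a < b + 1 ↔ a ≤ b := by
  refine ⟨fun h => ?_, fun h => h.trans_lt (num_lt_add_one b)⟩
  obtain ⟨c, hc⟩ := exists_add_of_le h.le
  obtain rfl | ⟨d, rfl⟩ := eq_zero_or_eq_add_one c
  · rw [add_zero] at hc
    exact absurd h (hc ▸ lt_irrefl _)
  · rw [← add_assoc] at hc
    exact le_of_le_of_eq le_self_add (add_right_cancel hc).symm

theorem num_add_one_le_iff {a b : M.Num} : a + 1 ≤ b ↔ a < b := by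
  rw [← not_lt, num_lt_add_one_iff, not_le]

/-! ### Closure properties of `Σ⁰₁` definability -/

theorem IsSig.congr {P Q : (ℕ → M.Num) → Prop} (hP : M.IsSig P) (h : ∀ v, P v ↔ Q v) :
    M.IsSig Q := by
  rwa [← funext fun v => propext (h v)]

theorem IsSig.subst {P : (ℕ → M.Num) → Prop} (hP : M.IsSig P) {τ : (ℕ → M.Num) → ℕ → M.Num}
    (hτ : ∀ i, M.IsTerm fun v => τ v i) : M.IsSig fun v => P (τ v) := by
  obtain ⟨Q, hQ, h⟩ := hP
  exact ⟨fun v x => Q (τ v) x, hQ.subst_cons (.var 0) fun i => (hτ i).shift, fun v => h (τ v)⟩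

/-- Two unbounded quantifiers merge into one over a common bound, so no pairing is required. -/
theorem IsSig.ex {P : (ℕ → M.Num) → M.Num → Prop}
    (hP : M.IsSig fun w => P (fun i => w (i + 1)) (w 0)) : M.IsSig fun v => ∃ a, P v a := by
  obtain ⟨Q, hQ, h⟩ := hP
  refine ⟨fun v z => ∃ a, a < z ∧ ∃ x, x < z ∧ Q (cons a v) x, .bex (.var 0) (.bex (.var 1)
    (hQ.subst_cons (.var 0) (isTerm_cons (.var 1) fun i => .var (i + 3)))), fun v => ?_⟩
  constructor
  · rintro ⟨a, ha⟩
    obtain ⟨x, hx⟩ := (h (cons a v)).1 ha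
    exact ⟨a + x + 1, a, num_lt_add_one_iff.2 le_self_add, x,
      num_lt_add_one_iff.2 le_add_self, hx⟩
  · rintro ⟨z, a, -, x, -, hx⟩
    exact ⟨a, (h (cons a v)).2 ⟨x, hx⟩⟩

theorem IsSig.or {P P' : (ℕ → M.Num) → Prop} (hP : M.IsSig P) (hP' : M.IsSig P') :
    M.IsSig fun v => P v ∨ P' v := by
  obtain ⟨Q, hQ, h⟩ := hP
  obtain ⟨Q', hQ', h'⟩ := hP'
  exact ⟨fun v x => Q v x ∨ Q' v x, hQ.or hQ', fun v => by simp only [h, h', exists_or]⟩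

theorem IsSig.and_bdd {P P' : (ℕ → M.Num) → Prop} (hP : M.IsSig P) (hP' : M.IsBdd P') :
    M.IsSig fun v => P v ∧ P' v := by
  obtain ⟨Q, hQ, h⟩ := hP
  exact ⟨fun v x => Q v x ∧ P' v, hQ.and (hP'.subst fun i => .var (i + 1)),
    fun v => by simp only [h, exists_and_right]⟩

theorem IsSig.and {P P' : (ℕ → M.Num) → Prop} (hP : M.IsSig P) (hP' : M.IsSig P') :
    M.IsSig fun v => P v ∧ P' v := by
  obtain ⟨Q, hQ, h⟩ := hP
  have : M.IsSig fun v => ∃ x, P' v ∧ Q v x :=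
    .ex (P := fun v x => P' v ∧ Q v x)
      ((hP'.subst (τ := fun w i => w (i + 1)) fun i => .var (i + 1)).and_bdd hQ)
  exact this.congr fun v => by rw [h, exists_and_left, and_comm]

theorem IsSig.bex {f : (ℕ → M.Num) → M.Num} {P : (ℕ → M.Num) → M.Num → Prop} (hf : M.IsTerm f)
    (hP : M.IsSig fun w => P (fun i => w (i + 1)) (w 0)) :
    M.IsSig fun v => ∃ a, a < f v ∧ P v a :=
  .ex ((IsBdd.lt (.var 0) hf.shift).sig.and hP)

/-- `Σ⁰₁` collection. -/
theorem collection {Q : (ℕ → M.Num) → M.Num → Prop}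
    (hQ : M.IsBdd fun w => Q (fun i => w (i + 1)) (w 0)) (v : ℕ → M.Num) (b : M.Num)
    (h : ∀ a, a < b → ∃ x, Q (cons a v) x) : ∃ z, ∀ a, a < b → ∃ x, x < z ∧ Q (cons a v) x := by
  have := sigma_induction (P := fun n => n ≤ b → ∃ z, ∀ a, a < n → ∃ x, x < z ∧ Q (cons a v) x)
    ⟨fun u z => u 0 ≤ b → ∀ a, a < u 0 → ∃ x, x < z ∧ Q (cons a v) x,
      .imp (.le (.var 1) (.const b)) (.ball (.var 1) (.bex (.var 1) (hQ.subst_cons (.var 0)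
        (isTerm_cons (.var 1) fun i => .const (v i))))), fun u => ?_⟩ ?_ ?_ b
  · exact this le_rfl
  · by_cases hu : u 0 ≤ b <;> simp [hu]
  · exact fun _ => ⟨0, fun a ha => absurd ha (num_zero_le a).not_gt⟩
  · intro n hn hnb
    have hlt := num_add_one_le_iff.1 hnb
    obtain ⟨z, hz⟩ := hn hlt.le
    obtain ⟨y, hy⟩ := h n hlt
    refine ⟨z + (y + 1), fun a ha => ?_⟩
    rcases (num_lt_add_one_iff.1 ha).lt_or_eq with h1 | rfl
    · obtain ⟨x, hx, hQx⟩ := hz a h1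
      exact ⟨x, hx.trans_le le_self_add, hQx⟩
    · exact ⟨y, (num_lt_add_one y).trans_le le_add_self, hy⟩

theorem IsSig.ball {f : (ℕ → M.Num) → M.Num} {P : (ℕ → M.Num) → M.Num → Prop} (hf : M.IsTerm f)
    (hP : M.IsSig fun w => P (fun i => w (i + 1)) (w 0)) :
    M.IsSig fun v => ∀ a, a < f v → P v a := by
  obtain ⟨Q, hQ, h⟩ := hP
  refine ⟨fun v z => ∀ a, a < f v → ∃ x, x < z ∧ Q (cons a v) x, .ball hf.shift (.bex (.var 1)
    (hQ.subst_cons (.var 0) (isTerm_cons (.var 1) fun i => .var (i + 3)))), fun v => ?_⟩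
  constructor
  · exact fun hv => collection hQ v (f v) fun a ha => (h (cons a v)).1 (hv a ha)
  · rintro ⟨z, hz⟩ a ha
    obtain ⟨x, -, hx⟩ := hz a ha
    exact (h (cons a v)).2 ⟨x, hx⟩

/-! ### Least number principles -/

/-- Without a least element, induction shows that `P` fails everywhere below `n`, which is `Σ⁰₁` by
collection. -/
theorem exists_least_of_pi {P : M.Num → Prop} (hP : M.IsSig fun v => ¬ P (v 0)) {a : M.Num}
    (ha : P a) : ∃ n, P n ∧ ∀ m, m < n → ¬ P m := by
  by_contra hno
  push Not at hno
  refine sigma_induction (P := fun n => ∀ y, y < n → ¬ P y) (.ball (.var 0)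
    (hP.subst (τ := fun w i => w i) fun i => .var i)) ?_ ?_ (a + 1) a (num_lt_add_one a) ha
  · exact fun y hy => absurd hy (num_zero_le y).not_gt
  · intro n hn y hy hPy
    rcases (num_lt_add_one_iff.1 hy).lt_or_eq with h | rfl
    · exact hn y h hPy
    · obtain ⟨m, hm, hPm⟩ := hno y hPy
      exact hn m hm hPm

/-- Failure below `n` would now be `Π⁰₁`. The induction instead counts `x` steps of descent from `a`
through elements satisfying `P`; `a + 1` steps are impossible. -/
theorem exists_least_of_sigma {P : M.Num → Prop} (hP : M.IsSig fun v => P (v 0)) {a : M.Num}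
    (ha : P a) : ∃ n, P n ∧ ∀ m, m < n → ¬ P m := by
  by_contra hno
  push Not at hno
  have := sigma_induction (P := fun x => ∃ y, y + x ≤ a ∧ P y) (.ex
    ((IsBdd.le (.add (.var 0) (.var 1)) (.const a)).sig.and
      (hP.subst (τ := fun w i => w i) fun i => .var i))) ⟨a, by simp, ha⟩ ?_ (a + 1)
  · obtain ⟨y, hy, -⟩ := this
    exact absurd ((le_add_self.trans hy)) (num_lt_add_one a).not_ge
  · rintro x ⟨y, hy, hPy⟩
    obtain ⟨m, hm, hPm⟩ := hno y hPy
    refine ⟨m, ?_, hPm⟩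
    calc m + (x + 1) = (m + 1) + x := by ring
      _ ≤ y + x := add_le_add_left (num_add_one_le_iff.2 hm) x
      _ ≤ a := hy

theorem exists_least_of_bdd {P : M.Num → Prop} (hP : M.IsBdd fun v => P (v 0)) {a : M.Num}
    (ha : P a) : ∃ n, P n ∧ ∀ m, m < n → ¬ P m :=
  exists_least_of_sigma hP.sig ha

/-! ### Bounded `Σ⁰₁` comprehension -/

theorem isBdd_dvd {f g : (ℕ → M.Num) → M.Num} (hf : M.IsTerm f) (hg : M.IsTerm g) :
    M.IsBdd fun v => f v ∣ g v := by
  refine (IsBdd.bex (P := fun v q => g v = f v * q) (hg.add (.const 1))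
    (.eq hg.shift (hf.shift.mul (.var 0)))).congr fun v => ⟨fun ⟨q, _, h⟩ => ⟨q, h⟩, ?_⟩
  rintro ⟨q, h⟩
  rcases (num_zero_le (f v)).lt_or_eq with h0 | h0
  · refine ⟨q, num_lt_add_one_iff.2 ?_, h⟩
    rw [h]
    simpa using mul_le_mul_of_nonneg_right (num_add_one_le_iff.2 h0) (num_zero_le q)
  -- For divisor `0` the given quotient may exceed the bound, but the dividend is `0` and the
  -- quotient `0` serves.
  · exact ⟨0, by simp, by simp [h, ← h0]⟩

theorem num_dvd_of_dvd_add {p a b : M.Num} (h : p ∣ a + b) (ha : p ∣ a) : p ∣ b := by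
  obtain ⟨x, hx⟩ := h
  obtain ⟨y, rfl⟩ := ha
  rcases le_total y x with hyx | hxy
  · obtain ⟨c, rfl⟩ := exists_add_of_le hyx
    exact ⟨c, add_left_cancel (hx.trans (mul_add p y c))⟩
  · have h1 : p * y + b ≤ p * y + 0 := by
      rw [hx, add_zero]
      exact mul_le_mul_of_nonneg_left hxy (num_zero_le p)
    have h2 : b = 0 := le_antisymm (le_of_add_le_add_left h1) (num_zero_le b)
    simp [h2]

/-- The moduli `m * (i + 1) + 1` for `i < k` are coprime if `m` is divisible by all positive
numbers up to `k`. -/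
theorem modulus_dvd_of_dvd_mul {m k i j n : M.Num} (hm : ∀ d, 0 < d → d ≤ k → d ∣ m) (hi : i < k)
    (hj : j < k) (hij : i ≠ j) (h : m * (j + 1) + 1 ∣ (m * (i + 1) + 1) * n) :
    m * (j + 1) + 1 ∣ n := by
  -- Modulo `m * (j + 1) + 1` the number `m * (j + 1)` is `-1`. Writing `m = d * r` and multiplying
  -- `m * d * n` by `r * (j + 1) * (j + 1)` gives the square of `m * (j + 1)` times `n`, which is
  -- congruent to `n`. Below, `d` is the distance of `i` and `j`.
  have reduce : ∀ d, 0 < d → d ≤ k → m * (j + 1) + 1 ∣ m * d * n → m * (j + 1) + 1 ∣ n := by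
    intro d hd hdk hdvd
    obtain ⟨r, hr⟩ := hm d hd hdk
    have h1 : m * (j + 1) + 1 ∣ (m * (j + 1)) * (m * (j + 1)) * n := by
      have := Dvd.dvd.mul_left hdvd (r * (j + 1) * (j + 1))
      have e : r * (j + 1) * (j + 1) * (m * d * n) =
        (m * (j + 1)) * ((d * r) * (j + 1)) * n := by ring
      rwa [e, ← hr] at this
    have h2 := dvd_add h1 (dvd_mul_right (m * (j + 1) + 1) (2 * n))
    have e : (m * (j + 1)) * (m * (j + 1)) * n + (m * (j + 1) + 1) * (2 * n) =
      (m * (j + 1) + 1) * ((m * (j + 1) + 1) * n) + n := by ring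
    exact num_dvd_of_dvd_add (e ▸ h2) (dvd_mul_right _ _)
  rcases lt_or_gt_of_ne hij with hlt | hlt
  · obtain ⟨d, rfl⟩ := exists_add_of_le hlt.le
    refine reduce d (pos_of_lt_add_right hlt) (le_add_self.trans hj.le) ?_
    refine num_dvd_of_dvd_add (a := (m * (i + 1) + 1) * n) ?_ h
    exact ⟨n, by ring⟩
  · obtain ⟨d, rfl⟩ := exists_add_of_le hlt.le
    refine reduce d (pos_of_lt_add_right hlt) (le_add_self.trans hi.le) ?_
    refine num_dvd_of_dvd_add (a := (m * (j + 1) + 1) * n) ?_ (dvd_mul_right _ _)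
    have e : (m * (j + 1) + 1) * n + m * d * n = (m * (j + d + 1) + 1) * n := by ring
    rwa [e]

theorem exists_common_multiple (f : M.Num → M.Num) (hf : ∀ i, 0 < f i)
    (hterm : M.IsTerm fun v => f (v 0)) (k : M.Num) : ∃ m, 0 < m ∧ ∀ i, i < k → f i ∣ m := by
  refine sigma_induction (P := fun k => ∃ m, 0 < m ∧ ∀ i, i < k → f i ∣ m)
    ⟨fun v m => 0 < m ∧ ∀ i, i < v 0 → f i ∣ m, .and (.lt (.const 0) (.var 0))
      (.ball (.var 1) (isBdd_dvd hterm (.var 1))), fun v => Iff.rfl⟩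
    ⟨1, zero_lt_one, fun i hi => absurd hi (num_zero_le i).not_gt⟩ ?_ k
  rintro n ⟨m, hm, h⟩
  refine ⟨m * f n, mul_pos hm (hf n), fun i hi => ?_⟩
  rcases (num_lt_add_one_iff.1 hi).lt_or_eq with h1 | rfl
  · exact (h i h1).mul_right _
  · exact dvd_mul_left _ _

/-- Take the least positive `n` divisible by the moduli of all `i < k` with `P i`; being such an `n`
is `Π⁰₁`. If the modulus of some other `i` divided `n`, the quotient would be a smaller such number,
by coprimality. So divisibility of `n` decides `P` below `k`. -/
theorem bounded_sigma_comprehension {P : M.Num → Prop} (hP : M.IsSig fun v => P (v 0))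
    (k : M.Num) : {i | i < k ∧ P i} ∈ M.sets := by
  obtain ⟨m, hm0, hm⟩ := exists_common_multiple (fun i => i + 1)
    (fun i => num_lt_add_one_iff.2 (num_zero_le i)) (.add (.var 0) (.const 1)) k
  have hm' : ∀ d, 0 < d → d ≤ k → d ∣ m := by
    intro d hd hdk
    obtain rfl | ⟨i, rfl⟩ := eq_zero_or_eq_add_one d
    · exact absurd hd (lt_irrefl _)
    · exact hm i (num_add_one_le_iff.1 hdk)
  have hterm : M.IsTerm fun v => m * (v 0 + 1) + 1 :=
    .add (.mul (.const m) (.add (.var 0) (.const 1))) (.const 1)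
  obtain ⟨N, hN0, hN⟩ := exists_common_multiple (fun i => m * (i + 1) + 1)
    (fun i => num_lt_add_one_iff.2 (num_zero_le _)) hterm k
  obtain ⟨n, ⟨hn0, hn⟩, hleast⟩ := exists_least_of_pi
    (P := fun n => 0 < n ∧ ∀ i, i < k → P i → m * (i + 1) + 1 ∣ n) (a := N) (by
      have : M.IsSig fun v => v 0 ≤ 0 ∨
          ∃ i, i < k ∧ (P i ∧ ¬ m * (i + 1) + 1 ∣ v 0) :=
        (IsBdd.le (.var 0) (.const 0)).sig.or (.bex (.const k)
          (.and (hP.subst (τ := fun w i => w i) fun i => .var i)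
            (isBdd_dvd hterm (.var 1)).neg.sig))
      refine this.congr fun v => ?_
      rw [not_and_or, not_lt]
      push Not
      rfl) ⟨hN0, fun i hi _ => hN i hi⟩
  have key : {i | i < k ∧ P i} = {i | i < k ∧ m * (i + 1) + 1 ∣ n} := by
    ext i
    refine and_congr_right fun hi => ⟨hn i hi, fun hdvd => ?_⟩
    by_contra hPi
    obtain ⟨q, rfl⟩ := hdvd
    have hq0 : 0 < q := pos_of_mul_pos_right hn0 (num_zero_le _)
    refine hleast q ?_ ⟨hq0, fun j hj hPj => modulus_dvd_of_dvd_mul hm' hi hj ?_ (hn j hj hPj)⟩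
    · rw [add_mul, one_mul]
      exact lt_add_of_pos_left q (mul_pos (mul_pos hm0 (num_lt_add_one_iff.2 (num_zero_le i))) hq0)
    · rintro rfl
      exact hPi hPj
  rw [key]
  exact bdd_comprehension (.and (.lt (.var 0) (.const k)) (isBdd_dvd hterm (.const n)))

/-- Strong `Σ⁰₁` collection. -/
theorem strong_collection {Q : M.Num → M.Num → Prop} (hQ : M.IsBdd fun w => Q (w 1) (w 0))
    (b : M.Num) : ∃ z, ∀ a, a < b → (∃ x, Q a x) → ∃ x, x < z ∧ Q a x := by
  -- With the set of those `a < b` that have a witness as a parameter, the relation becomes total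
  -- below `b`, and ordinary collection applies.
  have hX := bounded_sigma_comprehension (P := fun a => ∃ x, Q a x)
    ⟨fun v x => Q (v 0) x, hQ, fun v => Iff.rfl⟩ b
  have := collection (Q := fun v x => v 0 ∈ {i | i < b ∧ ∃ x, Q i x} → Q (v 0) x)
    (.imp (.mem hX (.var 1)) hQ) (fun _ => 0) b fun a _ => by
      by_cases ha : a ∈ {i | i < b ∧ ∃ x, Q i x}
      · obtain ⟨x, hx⟩ := ha.2
        exact ⟨x, fun _ => hx⟩
      · exact ⟨0, fun h => absurd h ha⟩
  obtain ⟨z, hz⟩ := this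
  refine ⟨z, fun a ha hx => ?_⟩
  obtain ⟨x, hx1, hx2⟩ := hz a ha
  exact ⟨x, hx1, hx2 ⟨ha, hx⟩⟩

/-! ### Pairs -/

theorem le_mul_self (a : M.Num) : a ≤ a * a := by
  obtain rfl | ⟨b, rfl⟩ := eq_zero_or_eq_add_one a
  · simp
  · have e : (b + 1) * (b + 1) = (b + 1) + (b * b + b) := by ring
    rw [e]
    exact le_self_add

theorem left_le_pair (a b : M.Num) : a ≤ M.pair a b := le_add_self

theorem right_le_pair (a b : M.Num) : b ≤ M.pair a b :=
  (le_add_self.trans (le_mul_self (a + b))).trans le_self_add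

/-- The code lies between consecutive squares: `(c + d)² ≤ M.pair c d < (c + d + 1)²`. -/
theorem add_le_of_pair_le {a b c d : M.Num} (h : M.pair a b ≤ M.pair c d) : a + b ≤ c + d := by
  by_contra hlt
  obtain ⟨e, he⟩ := exists_add_of_le (num_add_one_le_iff.2 (not_le.1 hlt))
  refine absurd h (not_le.2 ?_)
  rw [pair_eq, pair_eq, he]
  have e1 : (c + d + 1 + e) * (c + d + 1 + e) + a =
      ((c + d) * (c + d) + c + 1) + (c + d + d + e * e + 2 * e * (c + d + 1) + a) := by ring
  rw [e1]
  exact (num_lt_add_one _).trans_le le_self_add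

theorem pair_inj {a b c d : M.Num} : M.pair a b = M.pair c d ↔ a = c ∧ b = d := by
  refine ⟨fun h => ?_, fun ⟨h, h'⟩ => h ▸ h' ▸ rfl⟩
  have hs : a + b = c + d := le_antisymm (add_le_of_pair_le h.le) (add_le_of_pair_le h.ge)
  rw [pair_eq, pair_eq, hs] at h
  have hac := add_left_cancel h
  subst hac
  exact ⟨rfl, add_left_cancel hs⟩

end Sigma

end Model

theorem Formula.IsBounded.isArithmetical {φ : Formula} (h : φ.IsBounded) : φ.IsArithmetical := by
  induction h <;> simp_all [Formula.IsArithmetical]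

namespace Model

section Arithmetical

variable {M : Model.{u}} [hM : Fact M.IsRCA0]

/-! ### Arithmetical comprehension and `Σ⁰₁` comprehension -/

variable (M) in
/-- The `Σ⁰₁` comprehension scheme. -/
def SigmaComprehension : Prop :=
  ∀ P : M.Num → Prop, (M.IsSig fun v => P (v 0)) → {n | P n} ∈ M.sets

theorem IsACA0.sigmaComprehension (h : M.IsACA0) : M.SigmaComprehension := by
  intro P hP
  obtain ⟨θ, _, ρ, σ, hθ, _, hP⟩ := IsSig.realize_two hP hP
  obtain ⟨X, hX, hXP⟩ := h.comprehension (.ex 0 θ) 2 hθ.isArithmetical ρ σ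
  have e : {n | P n} = X := Set.ext fun n => ((hXP n).trans (hP n).1).symm
  rwa [e]

/-- Under `Σ⁰₁` comprehension an unbounded quantifier can be eliminated in favour of a set of
coded tuples. -/
theorem SigmaComprehension.isBdd_exists_of_support (hc : M.SigmaComprehension) (n : ℕ) :
    ∀ P : (ℕ → M.Num) → M.Num → Prop, (M.IsBdd fun w => P (fun i => w (i + 1)) (w 0)) →
    (∀ v v' a, (∀ i < n + 1, v i = v' i) → (P v a ↔ P v' a)) →
    M.IsBdd fun v => ∃ a, P v a := by
  induction n with
  | zero =>
    intro P hP hs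
    -- Only variable `0` matters here, so constant assignments suffice and the quantified statement
    -- becomes membership in one set.
    have hX := hc (fun x => ∃ a, P (fun _ => x) a) ⟨fun v a => P (fun _ => v 0) a,
      hP.subst_cons (.var 0) fun _ => .var 1, fun _ => Iff.rfl⟩
    refine (IsBdd.mem hX (.var 0)).congr fun v => exists_congr fun a => hs _ _ _ fun i hi => ?_
    obtain rfl : i = 0 := by omega
    rfl
  | succ n ih =>
    intro P hP hs
    -- Variable `0` now codes the first two variables, which lowers the support by one; substituting
    -- the pairing term afterwards recovers `P`.
    have := ih (fun v a => ∃ x, x < v 0 + 1 ∧ ∃ y, y < v 0 + 1 ∧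
        (v 0 = M.pair x y ∧ P (cons x (cons y fun i => v (i + 1))) a))
      (.bex (.add (.var 1) (.const 1)) (.bex (.add (.var 2) (.const 1)) (.and
        (.eq (.var 3) (.pair (.var 1) (.var 0)))
        (hP.subst_cons (.var 2) (isTerm_cons (.var 1) (isTerm_cons (.var 0)
          fun i => .var (i + 4))))))) ?_
    · refine (this.subst (τ := fun v => cons (M.pair (v 0) (v 1)) fun i => v (i + 2))
        (isTerm_cons (.pair (.var 0) (.var 1)) fun i => .var (i + 2))).congr fun v =>
        exists_congr fun a => ?_
      have e : cons (v 0) (cons (v 1) fun i => v (i + 2)) = v := by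
        funext i
        match i with
        | 0 => rfl
        | 1 => rfl
        | i + 2 => rfl
      constructor
      · rintro ⟨x, -, y, -, hxy, hP⟩
        obtain ⟨rfl, rfl⟩ := pair_inj.1 hxy
        change P (cons (v 0) (cons (v 1) fun i => v (i + 2))) a at hP
        rwa [e] at hP
      · intro hP
        refine ⟨v 0, num_lt_add_one_iff.2 (left_le_pair _ _), v 1,
          num_lt_add_one_iff.2 (right_le_pair _ _), rfl, ?_⟩
        change P (cons (v 0) (cons (v 1) fun i => v (i + 2))) a
        rwa [e]
    · intro v v' a h
      rw [h 0 (by omega)]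
      refine exists_congr fun x => and_congr_right fun _ => exists_congr fun y =>
        and_congr_right fun _ => and_congr_right fun _ => hs _ _ _ fun i hi => ?_
      match i with
      | 0 => rfl
      | 1 => rfl
      | i + 2 => exact h (i + 1) (by omega)

theorem SigmaComprehension.isBdd_exists (hc : M.SigmaComprehension)
    {P : (ℕ → M.Num) → M.Num → Prop} (hP : M.IsBdd fun w => P (fun i => w (i + 1)) (w 0)) :
    M.IsBdd fun v => ∃ a, P v a := by
  obtain ⟨n, hn⟩ := hP.exists_support
  refine hc.isBdd_exists_of_support n P hP fun v v' a h => hn (cons a v) (cons a v') fun i hi => ?_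
  match i with
  | 0 => rfl
  | i + 1 => exact h i (by omega)

theorem isTerm_eval (t : NumTerm) : M.IsTerm fun ρ => t.eval M ρ := by
  induction t with
  | var i => exact .var i
  | zero => exact .const 0
  | one => exact .const 1
  | add s t hs ht => exact .add hs ht
  | mul s t hs ht => exact .mul hs ht

/-- Each number quantifier is absorbed into a new set parameter, so every arithmetical formula
becomes bounded. -/
theorem SigmaComprehension.isBdd_holds (hc : M.SigmaComprehension) (σ : ℕ → M.sets)
    {φ : Formula} (hφ : φ.IsArithmetical) : M.IsBdd fun ρ => φ.Holds M ρ σ := by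
  have quant : ∀ (i : ℕ) {P : (ℕ → M.Num) → Prop}, M.IsBdd P →
      M.IsBdd fun w => P (Function.update (fun j => w (j + 1)) i (w 0)) := by
    intro i P hP
    refine hP.subst fun j => ?_
    by_cases h : j = i
    · subst h
      simpa using .var 0
    · simpa [Function.update_of_ne h] using .var (j + 1)
  induction φ with
  | eq s t => exact .eq (isTerm_eval s) (isTerm_eval t)
  | lt s t => exact .lt (isTerm_eval s) (isTerm_eval t)
  | mem t X => exact .mem (σ X).2 (isTerm_eval t)
  | neg φ h => exact .neg (h hφ)
  | and φ ψ h h' => exact .and (h hφ.1) (h' hφ.2)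
  | or φ ψ h h' => exact .or (h hφ.1) (h' hφ.2)
  | imp φ ψ h h' => exact .imp (h hφ.1) (h' hφ.2)
  | all i φ h =>
    refine (hc.isBdd_exists (P := fun ρ a => ¬ φ.Holds M (Function.update ρ i a) σ)
      (quant i (h hφ).neg)).neg.congr fun ρ => ?_
    rw [not_exists_not]
    rfl
  | ex i φ h =>
    exact hc.isBdd_exists (P := fun ρ a => φ.Holds M (Function.update ρ i a) σ) (quant i (h hφ))
  | allSet X φ h => exact hφ.elim
  | exSet X φ h => exact hφ.elim

theorem SigmaComprehension.isACA0 (hc : M.SigmaComprehension) : M.IsACA0 where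
  basic := basicAxioms
  induction _ hX h0 hs := bdd_induction (.mem hX (.var 0)) h0 hs
  comprehension φ i hφ ρ σ := by
    refine ⟨{n | φ.Holds M (Function.update ρ i n) σ}, bdd_comprehension
      ((hc.isBdd_holds σ hφ).subst (τ := fun v => Function.update ρ i (v 0)) fun j => ?_),
      fun n => Iff.rfl⟩
    by_cases h : j = i
    · subst h
      simpa using .var 0
    · simpa [Function.update_of_ne h] using .const (ρ j)

/-! ### Codes of finite sets -/

theorem finMem_triple {a k m n : M.Num} :
    M.FinMem a (M.pair (M.pair k m) n) ↔ a < k ∧ m * (a + 1) + 1 ∣ n := by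
  constructor
  · rintro ⟨k', m', n', h, ha, q, hq⟩
    obtain ⟨h1, rfl⟩ := pair_inj.1 h
    obtain ⟨rfl, rfl⟩ := pair_inj.1 h1
    exact ⟨ha, q, hq.symm.trans (mul_comm q _)⟩
  · rintro ⟨ha, q, hq⟩
    exact ⟨k, m, n, rfl, ha, q, (mul_comm q _).trans hq.symm⟩

theorem triple_bounds {c k m n : M.Num} (h : M.pair (M.pair k m) n ≤ c) :
    k < c + 1 ∧ m < c + 1 ∧ n < c + 1 := by
  simp only [num_lt_add_one_iff]
  exact ⟨((left_le_pair k m).trans (left_le_pair _ n)).trans h,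
    ((right_le_pair k m).trans (left_le_pair _ n)).trans h, (right_le_pair _ n).trans h⟩

theorem FinMem.lt {a c : M.Num} (h : M.FinMem a c) : a < c := by
  obtain ⟨k, m, n, rfl, ha, -⟩ := h
  exact lt_of_lt_of_le ha ((left_le_pair k m).trans (left_le_pair _ n))

theorem isBdd_exists_triple {f : (ℕ → M.Num) → M.Num}
    {P : (ℕ → M.Num) → M.Num → M.Num → M.Num → Prop} (hf : M.IsTerm f)
    (hP : M.IsBdd fun w => P (fun i => w (i + 3)) (w 2) (w 1) (w 0)) :
    M.IsBdd fun v => ∃ k m n, f v = M.pair (M.pair k m) n ∧ P v k m n := by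
  refine (IsBdd.bex (P := fun v k => ∃ m, m < f v + 1 ∧ ∃ n, n < f v + 1 ∧
      (f v = M.pair (M.pair k m) n ∧ P v k m n)) (hf.add (.const 1))
    (.bex (hf.shift.add (.const 1)) (.bex (hf.shift.shift.add (.const 1)) (.and
      (.eq hf.shift.shift.shift (.pair (.pair (.var 2) (.var 1)) (.var 0))) hP)))).congr
    fun v => ?_
  constructor
  · rintro ⟨k, -, m, -, n, -, h⟩
    exact ⟨k, m, n, h⟩
  · rintro ⟨k, m, n, h⟩
    obtain ⟨hk, hm, hn⟩ := triple_bounds h.1.ge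
    exact ⟨k, hk, m, hm, n, hn, h⟩

theorem isBdd_finMem {f g : (ℕ → M.Num) → M.Num} (hf : M.IsTerm f) (hg : M.IsTerm g) :
    M.IsBdd fun v => M.FinMem (f v) (g v) := by
  refine (isBdd_exists_triple (P := fun v k m n => f v < k ∧ m * (f v + 1) + 1 ∣ n) hg
    (.and (.lt hf.shift.shift.shift (.var 2)) (isBdd_dvd (.add (.mul (.var 1)
      (.add hf.shift.shift.shift (.const 1))) (.const 1)) (.var 0)))).congr fun v => ?_
  refine exists_congr fun k => exists_congr fun m => exists_congr fun n =>
    and_congr_right fun _ => and_congr_right fun _ => exists_congr fun q => ?_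
  rw [eq_comm, mul_comm]
  rfl

variable (M) in
/-- `c` is a coded triple. -/
def IsTriple (c : M.Num) : Prop := ∃ k m n, c = M.pair (M.pair k m) n

theorem isBdd_isTriple {f : (ℕ → M.Num) → M.Num} (hf : M.IsTerm f) :
    M.IsBdd fun v => M.IsTriple (f v) :=
  (isBdd_exists_triple (P := fun _ _ _ _ => True) hf (.const True)).congr fun v => by
    simp [IsTriple]

/-- Elements are smaller than their code, so equality of the coded sets need only be tested below
`c`; this bounds all quantifiers. -/
theorem isFinCode_iff {c : M.Num} : M.IsFinCode c ↔ M.IsTriple c ∧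
    ∀ d, d < c → M.IsTriple d → ¬ ∀ a, a < c → (M.FinMem a d ↔ M.FinMem a c) := by
  refine and_congr_right fun _ => ?_
  have key : ∀ d, d < c → ((∀ a, a < c → (M.FinMem a d ↔ M.FinMem a c)) ↔
      ∀ a, M.FinMem a d ↔ M.FinMem a c) := by
    refine fun d hd => ⟨fun h a => ?_, fun h a _ => h a⟩
    by_cases ha : a < c
    · exact h a ha
    · exact iff_of_false (fun h' => ha (h'.lt.trans hd)) fun h' => ha h'.lt
  constructor
  · rintro h d hd ⟨k, m, n, rfl⟩
    rw [key _ hd]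
    exact h k m n hd
  · intro h k m n hd
    rw [← key _ hd]
    exact h _ hd ⟨k, m, n, rfl⟩

theorem isBdd_isFinCode {f : (ℕ → M.Num) → M.Num} (hf : M.IsTerm f) :
    M.IsBdd fun v => M.IsFinCode (f v) :=
  (IsBdd.and (isBdd_isTriple hf) (.ball (P := fun v d => M.IsTriple d →
    ¬ ∀ a, a < f v → (M.FinMem a d ↔ M.FinMem a (f v))) hf (.imp (isBdd_isTriple (.var 0))
    (.neg (.ball hf.shift (.iff (isBdd_finMem (.var 0) (.var 1))
      (isBdd_finMem (.var 0) hf.shift.shift))))))).congr fun _ => isFinCode_iff.symm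

theorem IsTriple.exists_isFinCode {c : M.Num} (hc : M.IsTriple c) :
    ∃ d, M.IsFinCode d ∧ ∀ a, M.FinMem a d ↔ M.FinMem a c := by
  obtain ⟨d, ⟨hd, hdc⟩, hleast⟩ := exists_least_of_bdd
    (P := fun d => M.IsTriple d ∧ ∀ a, a < d + c → (M.FinMem a d ↔ M.FinMem a c))
    (.and (isBdd_isTriple (.var 0)) (.ball (.add (.var 0) (.const c)) (.iff
      (isBdd_finMem (.var 0) (.var 1)) (isBdd_finMem (.var 0) (.const c)))))
    ⟨hc, fun _ _ => Iff.rfl⟩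
  have hdc : ∀ a, M.FinMem a d ↔ M.FinMem a c := by
    intro a
    by_cases ha : a < d + c
    · exact hdc a ha
    · exact iff_of_false (fun h => ha (h.lt.trans_le le_self_add))
        fun h => ha (h.lt.trans_le le_add_self)
  refine ⟨d, ⟨hd, fun k m n hlt h => hleast _ hlt ⟨⟨k, m, n, rfl⟩, fun a _ => ?_⟩⟩, hdc⟩
  rw [h, hdc]

theorem IsFinCode.ext {c d : M.Num} (hc : M.IsFinCode c) (hd : M.IsFinCode d)
    (h : ∀ a, M.FinMem a c ↔ M.FinMem a d) : c = d := by
  obtain ⟨k, m, n, hk⟩ := hc.1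
  obtain ⟨k', m', n', hk'⟩ := hd.1
  rcases lt_trichotomy c d with hlt | heq | hlt
  · exact absurd (fun a => hk ▸ h a) (hd.2 k m n (hk ▸ hlt))
  · exact heq
  · exact absurd (fun a => hk' ▸ (h a).symm) (hc.2 k' m' n' (hk' ▸ hlt))

theorem not_finMem_zero (a : M.Num) : ¬ M.FinMem a 0 := fun h => (num_zero_le a).not_gt h.lt

theorem isFinCode_zero : M.IsFinCode 0 :=
  isFinCode_iff.2 ⟨⟨0, 0, 0, by simp [pair_eq]⟩, fun d hd => absurd hd (num_zero_le d).not_gt⟩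

variable (M) in
/-- `c` is the code of the singleton `{q}`. -/
def IsSingletonCode (q c : M.Num) : Prop := M.IsFinCode c ∧ ∀ a, M.FinMem a c ↔ a = q

theorem isBdd_isSingletonCode {f g : (ℕ → M.Num) → M.Num} (hf : M.IsTerm f) (hg : M.IsTerm g) :
    M.IsBdd fun v => M.IsSingletonCode (f v) (g v) := by
  refine (IsBdd.and (isBdd_isFinCode hg) (.ball (P := fun v a => M.FinMem a (g v) ↔ a = f v)
    (hf.add (hg.add (.const 1))) (.iff (isBdd_finMem (.var 0) hg.shift)
      (.eq (.var 0) hf.shift)))).congr fun v => and_congr_right fun _ => ?_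
  refine ⟨fun h a => ?_, fun h a _ => h a⟩
  by_cases ha : a < f v + (g v + 1)
  · exact h a ha
  · refine iff_of_false (fun h' => ha ?_) ?_
    · exact h'.lt.trans_le (le_self_add.trans le_add_self)
    · rintro rfl
      exact ha ((num_lt_add_one _).trans_le (add_le_add_right le_add_self _))

/-- With bound and base `q + 1`, the number `(q + 1) * (q + 1) + 1` is the modulus of `q` itself. If
the modulus `p` of some `a < q` divided it, with `q = a + 1 + d`, then `p` would divide `(q + 1) *
(d + 1)`. As `p` is `1` modulo `q + 1`, it would divide `d + 1`, but `p > q > d`. -/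
theorem exists_isSingletonCode (q : M.Num) : ∃ c, M.IsSingletonCode q c := by
  obtain ⟨c, hc, h⟩ := IsTriple.exists_isFinCode (M := M)
    (c := M.pair (M.pair (q + 1) (q + 1)) ((q + 1) * (q + 1) + 1)) ⟨_, _, _, rfl⟩
  refine ⟨c, hc, fun a => ?_⟩
  rw [h, finMem_triple, num_lt_add_one_iff]
  constructor
  · rintro ⟨ha, r, hr⟩
    by_contra hne
    obtain ⟨d, hd⟩ := exists_add_of_le (num_add_one_le_iff.2 (lt_of_le_of_ne ha hne))
    obtain rfl | ⟨s, rfl⟩ := eq_zero_or_eq_add_one r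
    · rw [mul_zero] at hr
      exact absurd hr (lt_of_lt_of_le zero_lt_one le_add_self).ne'
    · have h1 : (q + 1) * (a + 1) + 1 + (q + 1) * (d + 1) =
          (q + 1) * (a + 1) + 1 + ((q + 1) * (a + 1) + 1) * s := by
        have e : (q + 1) * (q + 1) + 1 =
          (q + 1) * (a + 1) + 1 + (q + 1) * (d + 1) := by
          nth_rewrite 2 [hd]
          ring
        rw [← e, hr]
        ring
      have h2 := add_left_cancel h1
      have h3 : q + 1 ∣ s := by
        refine num_dvd_of_dvd_add (a := (q + 1) * ((a + 1) * s)) ⟨d + 1, ?_⟩ (dvd_mul_right _ _)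
        rw [h2]
        ring
      obtain ⟨t, rfl⟩ := h3
      have h4 : d + 1 = ((q + 1) * (a + 1) + 1) * t := by
        refine mul_left_cancel₀ (lt_of_lt_of_le zero_lt_one (le_add_self (a := 1) (b := q))).ne' ?_
        rw [h2]
        ring
      obtain rfl | ⟨u, rfl⟩ := eq_zero_or_eq_add_one t
      · rw [mul_zero] at h4
        exact absurd h4 (lt_of_lt_of_le zero_lt_one le_add_self).ne'
      · have h5 : q + (1 + (q * a + a + 1) + ((q + 1) * (a + 1) + 1) * u) = d + 1 := by
          rw [h4]
          ring
        have h6 : q + 1 ≤ d + 1 := by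
          rw [← h5, add_assoc, add_le_add_iff_left]
          exact le_self_add
        have h7 : d < q := by
          rw [hd]
          exact (num_lt_add_one d).trans_le (by rw [add_comm a, add_comm _ d, ← add_assoc]
                                                exact le_self_add)
        exact absurd (le_of_add_le_add_right h6) h7.not_ge
  · rintro rfl
    exact ⟨le_rfl, dvd_rfl⟩

theorem IsSingletonCode.unique {q c d : M.Num} (hc : M.IsSingletonCode q c)
    (hd : M.IsSingletonCode q d) : c = d :=
  hc.1.ext hd.1 fun a => (hc.2 a).trans (hd.2 a).symm

/-! ### Arithmetical comprehension makes principal lower sets effectively closed -/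

variable (M) in
/-- `c` is the code of `{{n}}` if `n` is in `D` and of the empty set otherwise. -/
def IsIndicatorCode (D : Set M.Num) (n c : M.Num) : Prop :=
  (n ∈ D ∧ ∃ s, s < c ∧ (M.IsSingletonCode n s ∧ M.IsSingletonCode s c)) ∨ (n ∉ D ∧ c = 0)

theorem IsIndicatorCode.finMem {D : Set M.Num} {n c i : M.Num} (h : M.IsIndicatorCode D n c) :
    M.FinMem i c ↔ n ∈ D ∧ M.IsSingletonCode n i := by
  obtain ⟨hn, s, -, hs, hc⟩ | ⟨hn, rfl⟩ := h
  · rw [hc.2]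
    exact ⟨fun h => ⟨hn, h ▸ hs⟩, fun h => h.2.unique hs⟩
  · exact iff_of_false (not_finMem_zero i) fun h => hn h.1

theorem IsIndicatorCode.isFinCode {D : Set M.Num} {n c : M.Num} (h : M.IsIndicatorCode D n c) :
    M.IsFinCode c := by
  obtain ⟨_, s, -, _, hc⟩ | ⟨_, rfl⟩ := h
  · exact hc.1
  · exact isFinCode_zero

theorem exists_isIndicatorCode (D : Set M.Num) (n : M.Num) : ∃ c, M.IsIndicatorCode D n c := by
  by_cases hn : n ∈ D
  · obtain ⟨s, hs⟩ := exists_isSingletonCode n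
    obtain ⟨c, hc⟩ := exists_isSingletonCode s
    exact ⟨c, Or.inl ⟨hn, s, ((hc.2 s).2 rfl).lt, hs, hc⟩⟩
  · exact ⟨0, Or.inr ⟨hn, rfl⟩⟩

theorem IsIndicatorCode.unique {D : Set M.Num} {n c d : M.Num} (hc : M.IsIndicatorCode D n c)
    (hd : M.IsIndicatorCode D n d) : c = d :=
  hc.isFinCode.ext hd.isFinCode fun _ => hc.finMem.trans hd.finMem.symm

theorem isBdd_isIndicatorCode {D : Set M.Num} (hD : D ∈ M.sets) {f g : (ℕ → M.Num) → M.Num}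
    (hf : M.IsTerm f) (hg : M.IsTerm g) : M.IsBdd fun v => M.IsIndicatorCode D (f v) (g v) :=
  .or (.and (.mem hD hf) (.bex hg (.and (isBdd_isSingletonCode hf.shift (.var 0))
    (isBdd_isSingletonCode (.var 0) hg.shift)))) (.and (.neg (.mem hD hf)) (.eq hg (.const 0)))

/-- Comprehension is needed for the downward closure of `E` alone; from its complement `D` in `Q`
the code is boundedly definable. -/
theorem SigmaComprehension.flatClosedForQuasiOrders (hc : M.SigmaComprehension) :
    M.FlatClosedForQuasiOrders := by
  intro Q R E hQR hE hEQ
  have hL : {q | ∃ e, e ∈ E ∧ M.pair q e ∈ R} ∈ M.sets :=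
    hc _ (.ex (IsBdd.and (.mem hE (.var 0)) (.mem hQR.rel_mem (.pair (.var 1) (.var 0)))).sig)
  have hD : {q | q ∈ Q ∧ ¬ q ∈ {q | ∃ e, e ∈ E ∧ M.pair q e ∈ R}} ∈ M.sets :=
    bdd_comprehension (.and (.mem hQR.carrier_mem (.var 0)) (.neg (.mem hL (.var 0))))
  set D := {q | q ∈ Q ∧ ¬ q ∈ {q | ∃ e, e ∈ E ∧ M.pair q e ∈ R}} with hDdef
  have hpair : ∀ n c, M.pair n c ∈ {z | ∃ n, n < z + 1 ∧ ∃ c, c < z + 1 ∧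
      (z = M.pair n c ∧ M.IsIndicatorCode D n c)} ↔ M.IsIndicatorCode D n c := by
    intro n c
    constructor
    · rintro ⟨n', -, c', -, h, h'⟩
      obtain ⟨rfl, rfl⟩ := pair_inj.1 h
      exact h'
    · exact fun h => ⟨n, num_lt_add_one_iff.2 (left_le_pair n c), c,
        num_lt_add_one_iff.2 (right_le_pair n c), rfl, h⟩
  refine ⟨{z | ∃ n, n < z + 1 ∧ ∃ c, c < z + 1 ∧
    (z = M.pair n c ∧ M.IsIndicatorCode D n c)}, bdd_comprehension
    (.bex (.add (.var 0) (.const 1)) (.bex (.add (.var 1) (.const 1)) (.and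
      (.eq (.var 2) (.pair (.var 1) (.var 0)))
      (isBdd_isIndicatorCode hD (.var 1) (.var 0))))), ⟨?_, ?_⟩, ?_⟩
  · rintro z ⟨n, -, c, -, rfl, h⟩
    refine ⟨n, trivial, c, ⟨h.isFinCode, fun i hi => ?_⟩, rfl⟩
    obtain ⟨hn, hi⟩ := h.finMem.1 hi
    exact ⟨hi.1, fun q hq => (hi.2 q).1 hq ▸ hn.1⟩
  · intro n _
    obtain ⟨c, h⟩ := exists_isIndicatorCode D n
    exact ⟨c, (hpair n c).2 h, fun d hd => ((hpair n d).1 hd).unique h⟩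
  · intro X _ hXQ
    constructor
    · intro hXE n c hnc i hi hX
      obtain ⟨hn, hi⟩ := ((hpair n c).1 hnc).finMem.1 hi
      obtain ⟨x, hx, hnx⟩ := hX n ((hi.2 n).2 rfl)
      obtain ⟨e, he, hxe⟩ := hXE x hx
      exact hn.2 ⟨e, he, hQR.trans n hn.1 x (hXQ hx) e (hEQ he) hnx hxe⟩
    · intro hX x hx
      by_contra hxE
      obtain ⟨c, h⟩ := exists_isIndicatorCode D x
      obtain ⟨i, hi⟩ := exists_isSingletonCode x
      refine hX x c ((hpair x c).2 h) i (h.finMem.2 ⟨⟨hXQ hx, hxE⟩, hi⟩) fun q hq => ?_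
      rw [(hi.2 q).1 hq]
      exact ⟨x, hx, hQR.refl x (hXQ hx)⟩

end Arithmetical

end Model

/-! ### The order of true and false stages of a function -/

section Stages

variable {α β : Type*} [LinearOrder α] [LinearOrder β] (f : α → β)

/-- The stage `a` is seen to be false at `b`: a smaller value is attained after `a` up to `b`. -/
def FalseAt (a b : α) : Prop := ∃ k, a < k ∧ k ≤ b ∧ f k < f a

/-- No smaller value is attained after the stage `a`. -/
def TrueStage (a : α) : Prop := ∀ k, a < k → f a ≤ f k

/-- The linear order on stages in which `b` is put above the earlier stages that are false at
`b`, and below those that are not. -/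
def StageLE (a b : α) : Prop := a = b ∨ (a < b ∧ FalseAt f a b) ∨ (b < a ∧ ¬ FalseAt f b a)

variable {f}

theorem FalseAt.mono {a b c : α} (h : FalseAt f a b) (hbc : b ≤ c) : FalseAt f a c := by
  obtain ⟨k, h1, h2, h3⟩ := h
  exact ⟨k, h1, h2.trans hbc, h3⟩

/-- If the smaller value comes after `b`, compare `f a` with `f b`: either it also lies below `f b`,
or `b` itself shows that `a` is false. This is what makes `StageLE` transitive. -/
theorem FalseAt.split {a b c : α} (h : FalseAt f a c) (hab : a < b) :
    FalseAt f a b ∨ FalseAt f b c := by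
  obtain ⟨k, h1, h2, h3⟩ := h
  rcases le_or_gt k b with hk | hk
  · exact Or.inl ⟨k, h1, hk, h3⟩
  rcases le_or_gt (f a) (f b) with hf | hf
  · exact Or.inr ⟨k, hk, h2, h3.trans_le hf⟩
  · exact Or.inl ⟨b, hab, le_rfl, hf⟩

theorem TrueStage.not_falseAt {a b : α} (h : TrueStage f a) : ¬ FalseAt f a b := by
  rintro ⟨k, h1, -, h3⟩
  exact (h k h1).not_gt h3

theorem stageLE_total (a b : α) : StageLE f a b ∨ StageLE f b a := by
  rcases lt_trichotomy a b with h | h | h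
  · by_cases hF : FalseAt f a b
    · exact Or.inl (Or.inr (Or.inl ⟨h, hF⟩))
    · exact Or.inr (Or.inr (Or.inr ⟨h, hF⟩))
  · exact Or.inl (Or.inl h)
  · by_cases hF : FalseAt f b a
    · exact Or.inr (Or.inr (Or.inl ⟨h, hF⟩))
    · exact Or.inl (Or.inr (Or.inr ⟨h, hF⟩))

theorem StageLE.antisymm {a b : α} (hab : StageLE f a b) (hba : StageLE f b a) : a = b := by
  rcases hab with h | ⟨h, h1⟩ | ⟨h, h1⟩
  · exact h
  · rcases hba with h' | ⟨h', h2⟩ | ⟨h', h2⟩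
    · exact h'.symm
    · exact absurd h h'.not_gt
    · exact absurd h1 h2
  · rcases hba with h' | ⟨h', h2⟩ | ⟨h', h2⟩
    · exact h'.symm
    · exact absurd h2 h1
    · exact absurd h h'.not_gt

theorem StageLE.trans {a b c : α} (hab : StageLE f a b) (hbc : StageLE f b c) :
    StageLE f a c := by
  rcases hab with rfl | ⟨h, h1⟩ | ⟨h, h1⟩
  · exact hbc
  · rcases hbc with rfl | ⟨h', h2⟩ | ⟨h', h2⟩
    · exact Or.inr (Or.inl ⟨h, h1⟩)
    · exact Or.inr (Or.inl ⟨h.trans h', h1.mono h'.le⟩)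
    · rcases lt_trichotomy a c with hac | hac | hac
      · exact Or.inr (Or.inl ⟨hac, (h1.split hac).resolve_right h2⟩)
      · exact Or.inl hac
      · exact Or.inr (Or.inr ⟨hac, fun hF => h2 (hF.mono h.le)⟩)
  · rcases hbc with rfl | ⟨h', h2⟩ | ⟨h', h2⟩
    · exact Or.inr (Or.inr ⟨h, h1⟩)
    · rcases lt_trichotomy a c with hac | hac | hac
      · exact Or.inr (Or.inl ⟨hac, (h2.split h).resolve_left h1⟩)
      · exact Or.inl hac
      · exact absurd (h2.mono hac.le) h1
    · exact Or.inr (Or.inr ⟨h'.trans h, fun hF => (hF.split h').elim h2 h1⟩)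

end Stages

namespace Model

/-! ### The reversal: stages of a function that enumerates a `Σ⁰₁` set -/

section Reversal

variable {M : Model.{u}} [hM : Fact M.IsRCA0]

variable (M) in
/-- `x` is the first witness of `P n`. -/
def IsFirst (P : M.Num → M.Num → Prop) (n x : M.Num) : Prop := P n x ∧ ∀ y, y < x → ¬ P n y

open Classical in
/-- The stage `k` has the value `n` if it codes a pair of `n` and the first witness of `P n`,
and the value `k` if there are no such `n`. -/
noncomputable def stageValue (P : M.Num → M.Num → Prop) (k : M.Num) : M.Num :=
  if h : ∃ n x, k = M.pair n x ∧ M.IsFirst P n x then h.choose else k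

variable {P : M.Num → M.Num → Prop}

theorem stageValue_pair {n x : M.Num} (h : M.IsFirst P n x) :
    stageValue P (M.pair n x) = n := by
  have hex : ∃ m y, M.pair n x = M.pair m y ∧ M.IsFirst P m y := ⟨n, x, rfl, h⟩
  rw [stageValue, dif_pos hex]
  obtain ⟨y, hy, -⟩ := hex.choose_spec
  exact (pair_inj.1 hy).1.symm

/-- Components of a pair are bounded by its code, which gives the graph a bounded definition. -/
theorem stageValue_eq_iff {k u : M.Num} : stageValue P k = u ↔
    (∃ x, x < k + 1 ∧ (k = M.pair u x ∧ M.IsFirst P u x)) ∨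
      (k = u ∧ ∀ n, n < k + 1 → ∀ x, x < k + 1 → k = M.pair n x → ¬ M.IsFirst P n x) := by
  by_cases hex : ∃ n x, k = M.pair n x ∧ M.IsFirst P n x
  · obtain ⟨n, x, rfl, h⟩ := hex
    rw [stageValue_pair h]
    constructor
    · rintro rfl
      exact Or.inl ⟨x, num_lt_add_one_iff.2 (right_le_pair _ _), rfl, h⟩
    · rintro (⟨y, -, hy, -⟩ | ⟨-, hno⟩)
      · exact (pair_inj.1 hy).1
      · exact absurd h (hno n (num_lt_add_one_iff.2 (left_le_pair _ _)) x
          (num_lt_add_one_iff.2 (right_le_pair _ _)) rfl)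
  · rw [stageValue, dif_neg hex]
    constructor
    · exact fun h => Or.inr ⟨h, fun n _ x _ hk hf => hex ⟨n, x, hk, hf⟩⟩
    · rintro (⟨x, -, h⟩ | ⟨h, -⟩)
      · exact absurd ⟨u, x, h⟩ hex
      · exact h

theorem stageValue_le (k : M.Num) : stageValue P k ≤ k := by
  obtain ⟨x, -, h, -⟩ | ⟨h, -⟩ := (stageValue_eq_iff (P := P) (k := k)).1 rfl
  · exact (left_le_pair _ x).trans h.ge
  · exact h.ge

variable (hP : M.IsBdd fun w => P (w 1) (w 0))
include hP

theorem isBdd_apply {f g : (ℕ → M.Num) → M.Num} (hf : M.IsTerm f) (hg : M.IsTerm g) :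
    M.IsBdd fun v => P (f v) (g v) :=
  hP.subst (τ := fun v => cons (g v) fun _ => f v) (isTerm_cons hg fun _ => hf)

theorem isBdd_isFirst {f g : (ℕ → M.Num) → M.Num} (hf : M.IsTerm f) (hg : M.IsTerm g) :
    M.IsBdd fun v => M.IsFirst P (f v) (g v) :=
  .and (isBdd_apply hP hf hg) (.ball hg (.neg (isBdd_apply hP hf.shift (.var 0))))

theorem isBdd_stageValue_eq {f g : (ℕ → M.Num) → M.Num} (hf : M.IsTerm f) (hg : M.IsTerm g) :
    M.IsBdd fun v => stageValue P (f v) = g v :=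
  (IsBdd.or (.bex (P := fun v x => f v = M.pair (g v) x ∧ M.IsFirst P (g v) x)
      (hf.add (.const 1)) (.and (.eq hf.shift (hg.shift.pair (.var 0)))
        (isBdd_isFirst hP hg.shift (.var 0))))
    (.and (.eq hf hg) (.ball (P := fun v n => ∀ x, x < f v + 1 → f v = M.pair n x →
      ¬ M.IsFirst P n x) (hf.add (.const 1)) (.ball (hf.shift.add (.const 1))
        (.imp (.eq hf.shift.shift (.pair (.var 1) (.var 0)))
          (.neg (isBdd_isFirst hP (.var 1) (.var 0)))))))).congr
    fun _ => stageValue_eq_iff.symm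

theorem isBdd_stageValue_lt {f g : (ℕ → M.Num) → M.Num} (hf : M.IsTerm f) (hg : M.IsTerm g) :
    M.IsBdd fun v => stageValue P (f v) < stageValue P (g v) := by
  refine (IsBdd.bex (P := fun v a => ∃ b, b < g v + 1 ∧ ((stageValue P (f v) = a ∧
      stageValue P (g v) = b) ∧ a < b)) (hf.add (.const 1)) (.bex (hg.shift.add (.const 1))
    (.and (.and (isBdd_stageValue_eq hP hf.shift.shift (.var 1))
      (isBdd_stageValue_eq hP hg.shift.shift (.var 0))) (.lt (.var 1) (.var 0))))).congr
    fun v => ?_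
  constructor
  · rintro ⟨a, -, b, -, ⟨rfl, rfl⟩, h⟩
    exact h
  · exact fun h => ⟨_, num_lt_add_one_iff.2 (stageValue_le _), _,
      num_lt_add_one_iff.2 (stageValue_le _), ⟨rfl, rfl⟩, h⟩

theorem isBdd_falseAt {f g : (ℕ → M.Num) → M.Num} (hf : M.IsTerm f) (hg : M.IsTerm g) :
    M.IsBdd fun v => FalseAt (stageValue P) (f v) (g v) := by
  refine (IsBdd.bex (P := fun v k => f v < k ∧ stageValue P k < stageValue P (f v))
    (hg.add (.const 1)) (.and (.lt hf.shift (.var 0))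
      (isBdd_stageValue_lt hP (.var 0) hf.shift))).congr fun v => exists_congr fun k => ?_
  rw [num_lt_add_one_iff]
  tauto

theorem isBdd_stageLE {f g : (ℕ → M.Num) → M.Num} (hf : M.IsTerm f) (hg : M.IsTerm g) :
    M.IsBdd fun v => StageLE (stageValue P) (f v) (g v) :=
  .or (.eq hf hg) (.or (.and (.lt hf hg) (isBdd_falseAt hP hf hg))
    (.and (.lt hg hf) (.neg (isBdd_falseAt hP hg hf))))

theorem exists_isFirst {n x : M.Num} (h : P n x) : ∃ y, M.IsFirst P n y :=
  exists_least_of_bdd (isBdd_apply hP (.const n) (.var 0)) h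

/-- The values tend to infinity: strong collection bounds the first witnesses of all `n ≤ y` by one
`z`. -/
theorem exists_forall_lt_stageValue (y : M.Num) :
    ∃ s, ∀ k, s ≤ k → y < stageValue P k := by
  obtain ⟨z, hz⟩ := strong_collection hP (y + 1)
  -- The bound is one more than `M.pair y z`, which dominates both kinds of stages with a value up
  -- to `y`.
  refine ⟨(y + z) * (y + z) + y + 1, fun k hk => ?_⟩
  by_contra hlt
  have hky := not_lt.1 hlt
  obtain ⟨x, -, h, hx⟩ | ⟨h, -⟩ := (stageValue_eq_iff (P := P) (k := k)).1 rfl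
  · obtain ⟨x', hx', hP'⟩ := hz _ (num_lt_add_one_iff.2 hky) ⟨x, hx.1⟩
    have hxz : x ≤ z := (not_lt.1 fun h' => hx.2 x' h' hP').trans hx'.le
    refine (num_add_one_le_iff.1 hk).not_ge ?_
    have hs := add_le_add hky hxz
    rw [h, pair_eq]
    exact add_le_add (mul_le_mul hs hs (num_zero_le _) (num_zero_le _)) hky
  · refine (num_add_one_le_iff.1 hk).not_ge ?_
    rw [h]
    exact hky.trans le_add_self

/-- A stage of least value among those from `s` on is true. -/
theorem exists_trueStage (s : M.Num) : ∃ k, s ≤ k ∧ TrueStage (stageValue P) k := by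
  obtain ⟨u, ⟨k, hk, rfl⟩, hleast⟩ := exists_least_of_sigma
    (P := fun u => ∃ k, s ≤ k ∧ stageValue P k = u)
    (.ex (IsBdd.and (.le (.const s) (.var 0)) (isBdd_stageValue_eq hP (.var 0) (.var 1))).sig)
    ⟨s, le_rfl, rfl⟩
  exact ⟨k, hk, fun j hj => not_lt.1 fun h => hleast _ h ⟨j, hk.trans hj.le, rfl⟩⟩

/-- If `s` is true with value above `n`, the stage of the first witness of `n` cannot come after
`s`. So testing the `x ≤ s` settles whether `n` has a witness, and having none is `Σ⁰₁`. -/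
theorem setOf_exists_mem_of_trueStages {U : M.Num → Prop} (hU : M.IsSig fun v => U (v 0))
    (htrue : ∀ s, U s → TrueStage (stageValue P) s) (hunb : ∀ b, ∃ s, b ≤ s ∧ U s) :
    {n | ∃ x, P n x} ∈ M.sets := by
  refine delta_comprehension (.ex (isBdd_apply hP (.var 1) (.var 0)).sig) ?_
  have hS : M.IsSig fun v => ∃ s, U s ∧ ((∃ u, u < s + 1 ∧ (stageValue P s = u ∧ v 0 < u)) ∧
      ∀ x, x < s + 1 → ¬ P (v 0) x) :=
    .ex ((hU.subst (τ := fun w i => w i) fun i => .var i).and (IsBdd.and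
      (.bex (.add (.var 0) (.const 1)) (.and (isBdd_stageValue_eq hP (.var 1) (.var 0))
        (.lt (.var 2) (.var 0))))
      (.ball (.add (.var 0) (.const 1)) (.neg (isBdd_apply hP (.var 2) (.var 0))))).sig)
  refine hS.congr fun v => ?_
  constructor
  · rintro ⟨s, hs, ⟨u, -, rfl, hvu⟩, hno⟩ ⟨x, hx⟩
    obtain ⟨y, hy⟩ := exists_isFirst hP hx
    rcases le_or_gt (M.pair (v 0) y) s with hle | hlt
    · exact hno y (num_lt_add_one_iff.2 ((right_le_pair _ _).trans hle)) hy.1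
    · have := htrue s hs _ hlt
      rw [stageValue_pair hy] at this
      exact this.not_gt hvu
  · intro hno
    obtain ⟨b, hb⟩ := exists_forall_lt_stageValue hP (v 0)
    obtain ⟨s, hbs, hs⟩ := hunb b
    exact ⟨s, hs, ⟨_, num_lt_add_one_iff.2 (stageValue_le s), rfl, hb s hbs⟩,
      fun x _ hx => hno ⟨x, hx⟩⟩

/-! ### The order of stages inside the model -/

variable (P) in
omit hP in
/-- The set of pairs in the order of stages. -/
def stageRel : Set M.Num :=
  {z | ∃ a, a < z + 1 ∧ ∃ b, b < z + 1 ∧ (z = M.pair a b ∧ StageLE (stageValue P) a b)}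

omit hP in
theorem pair_mem_stageRel {a b : M.Num} :
    M.pair a b ∈ stageRel P ↔ StageLE (stageValue P) a b := by
  constructor
  · rintro ⟨a', -, b', -, h, h'⟩
    obtain ⟨rfl, rfl⟩ := pair_inj.1 h
    exact h'
  · exact fun h => ⟨a, num_lt_add_one_iff.2 (left_le_pair a b), b,
      num_lt_add_one_iff.2 (right_le_pair a b), rfl, h⟩

theorem stageRel_mem : stageRel P ∈ M.sets :=
  bdd_comprehension (.bex (.add (.var 0) (.const 1)) (.bex (.add (.var 1) (.const 1)) (.and
    (.eq (.var 2) (.pair (.var 1) (.var 0))) (isBdd_stageLE hP (.var 1) (.var 0)))))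

theorem exists_stageLE_min {X : Set M.Num} (hX : X ∈ M.sets) {k x : M.Num} (hxk : x < k)
    (hx : x ∈ X) :
    ∃ y, y < k ∧ (y ∈ X ∧ ∀ z, z < k → z ∈ X → StageLE (stageValue P) y z) := by
  refine bdd_induction (P := fun k => (∃ x, x < k ∧ x ∈ X) → ∃ y, y < k ∧
    (y ∈ X ∧ ∀ z, z < k → z ∈ X → StageLE (stageValue P) y z))
    (.imp (.bex (.var 0) (.mem hX (.var 0))) (.bex (.var 0) (.and (.mem hX (.var 0))
      (.ball (.var 1) (.imp (.mem hX (.var 0)) (isBdd_stageLE hP (.var 1) (.var 0)))))))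
    ?_ ?_ k ⟨x, hxk, hx⟩
  · rintro ⟨x, hx, -⟩
    exact absurd hx (num_zero_le x).not_gt
  · rintro n ih ⟨x, hx, hxX⟩
    by_cases hex : ∃ x, x < n ∧ x ∈ X
    · obtain ⟨y, hy, hyX, hmin⟩ := ih hex
      by_cases hn : n ∈ X ∧ StageLE (stageValue P) n y
      · refine ⟨n, num_lt_add_one n, hn.1, fun z hz hzX => ?_⟩
        rcases (num_lt_add_one_iff.1 hz).lt_or_eq with h | rfl
        · exact hn.2.trans (hmin z h hzX)
        · exact Or.inl rfl
      · refine ⟨y, hy.trans (num_lt_add_one n), hyX, fun z hz hzX => ?_⟩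
        rcases (num_lt_add_one_iff.1 hz).lt_or_eq with h | rfl
        · exact hmin z h hzX
        · exact (stageLE_total y z).resolve_right fun h => hn ⟨hzX, h⟩
    · push Not at hex
      have hxn : ∀ z, z < n + 1 → z ∈ X → z = n := fun z hz hzX =>
        le_antisymm (num_lt_add_one_iff.1 hz) (not_lt.1 fun h => hex z h hzX)
      exact ⟨x, hx, hxX, fun z hz hzX => Or.inl ((hxn x hx hxX).trans (hxn z hz hzX).symm)⟩

/-- A descending sequence of stages consists of true stages, and so computes the set that the
stages enumerate. -/
theorem setOf_exists_mem_of_descending {δ : M.Num → M.Num}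
    (hδ : {z | ∃ i, z = M.pair i (δ i)} ∈ M.sets)
    (hle : ∀ i, StageLE (stageValue P) (δ (i + 1)) (δ i)) (hne : ∀ i, δ (i + 1) ≠ δ i) :
    {n | ∃ x, P n x} ∈ M.sets := by
  have hmem : ∀ i b, M.pair i b ∈ {z | ∃ i, z = M.pair i (δ i)} ↔ b = δ i := by
    intro i b
    constructor
    · rintro ⟨j, hj⟩
      obtain ⟨rfl, rfl⟩ := pair_inj.1 hj
      rfl
    · rintro rfl
      exact ⟨i, rfl⟩
  have hgraph : ∀ {f g : (ℕ → M.Num) → M.Num}, M.IsTerm f → M.IsTerm g →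
      M.IsBdd fun v => g v = δ (f v) := fun hf hg =>
    (IsBdd.mem hδ (.pair hf hg)).congr fun v => hmem _ _
  by_cases htrue : ∀ i, TrueStage (stageValue P) (δ i)
  · refine setOf_exists_mem_of_trueStages hP (U := fun s => ∃ i, s = δ i)
      (.ex (hgraph (.var 0) (.var 1)).sig) (fun s ⟨i, hi⟩ => hi ▸ htrue i) fun b => ?_
    -- Among true stages, going down in the order means going to a later stage. The variable `c` is
    -- there because `δ` is given by its graph and is not a term.
    have hinc : ∀ i, ∃ c, c = δ i ∧ i ≤ c := by
      refine sigma_induction (.ex (IsBdd.and (hgraph (.var 1) (.var 0))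
        (.le (.var 1) (.var 0))).sig) ⟨_, rfl, num_zero_le _⟩ ?_
      rintro i ⟨c, rfl, hi⟩
      refine ⟨_, rfl, num_add_one_le_iff.2 (hi.trans_lt ?_)⟩
      rcases hle i with h | ⟨-, h⟩ | ⟨h, -⟩
      · exact absurd h (hne i)
      · exact absurd h (htrue _).not_falseAt
      · exact h
    obtain ⟨c, hc, hbc⟩ := hinc b
    exact ⟨c, hbc, b, hc⟩
  · exfalso
    unfold TrueStage at htrue
    push Not at htrue
    obtain ⟨i₀, k, hk, hlt⟩ := htrue
    -- The stage `δ i₀` is seen to be false at `k`, so every stage from `k` on lies above it. The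
    -- rest of the sequence is therefore confined to numbers below `k`, where its range is a set
    -- with a minimum.
    have hbelow : ∀ j, ∃ b, b = δ (i₀ + j) ∧ StageLE (stageValue P) b (δ i₀) := by
      refine sigma_induction (.ex (IsBdd.and (hgraph (.add (.const i₀) (.var 1)) (.var 0))
        (isBdd_stageLE hP (.var 0) (.const _))).sig) ⟨_, rfl, Or.inl (by rw [add_zero])⟩ ?_
      rintro j ⟨b, rfl, hb⟩
      refine ⟨_, rfl, StageLE.trans ?_ hb⟩
      rw [← add_assoc]
      exact hle _
    have hlt_k : ∀ j, δ (i₀ + j) < k := by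
      intro j
      obtain ⟨b, rfl, hb⟩ := hbelow j
      by_contra hkb
      have hkb := not_lt.1 hkb
      rcases hb with h | ⟨h, -⟩ | ⟨-, h⟩
      · exact absurd hk (not_lt.2 (hkb.trans h.le))
      · exact absurd (hk.trans_le hkb) h.not_gt
      · exact h ⟨k, hk, hkb, hlt⟩
    have hX := bounded_sigma_comprehension (P := fun t => ∃ j, t = δ (i₀ + j))
      (.ex (hgraph (.add (.const i₀) (.var 0)) (.var 1)).sig) k
    obtain ⟨y, -, ⟨-, j, rfl⟩, hmin⟩ := exists_stageLE_min hP hX (x := δ (i₀ + 0)) (hlt_k 0)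
      ⟨hlt_k 0, 0, rfl⟩
    have h1 := hmin (δ (i₀ + (j + 1))) (hlt_k _) ⟨hlt_k _, _, rfl⟩
    rw [← add_assoc] at h1
    exact hne _ ((hle _).antisymm h1)

/-- The true stages themselves descend without end; the order is well-founded only in the sense that
the model contains no descending sequence. -/
theorem isWellOrder_stageRel (hA : {n | ∃ x, P n x} ∉ M.sets) :
    M.IsWellOrder Set.univ (stageRel P) where
  carrier_mem := bdd_comprehension (IsBdd.const True)
  rel_mem := stageRel_mem hP
  rel_subset := by
    rintro z ⟨a, -, b, -, h, -⟩
    exact ⟨a, trivial, b, trivial, h⟩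
  refl a _ := pair_mem_stageRel.2 (Or.inl rfl)
  trans a _ b _ c _ hab hbc :=
    pair_mem_stageRel.2 ((pair_mem_stageRel.1 hab).trans (pair_mem_stageRel.1 hbc))
  antisymm a _ b _ hab hba := (pair_mem_stageRel.1 hab).antisymm (pair_mem_stageRel.1 hba)
  total a _ b _ := by
    rw [pair_mem_stageRel, pair_mem_stageRel]
    exact stageLE_total a b
  no_descending := by
    rintro ⟨d, hd, ⟨hdp, hdf⟩, hdesc⟩
    choose δ hδ hδu using fun i => hdf i trivial
    have hdδ : {z | ∃ i, z = M.pair i (δ i)} = d := by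
      ext z
      constructor
      · rintro ⟨i, rfl⟩
        exact hδ i
      · intro hz
        obtain ⟨i, -, b, -, rfl⟩ := hdp z hz
        exact ⟨i, congrArg _ (hδu i b hz)⟩
    have hdesc' := fun i => hdesc i _ _ (hδ i) (hδ (M.add i M.one))
    refine hA (setOf_exists_mem_of_descending hP (δ := δ) (hdδ ▸ hd)
      (fun i => pair_mem_stageRel.1 (hdesc' i).1) fun i h => (hdesc' i).2 ?_)
    exact pair_mem_stageRel.2 (Or.inl h.symm)

/-- If the values never dropped from `s` on, all stages from `s` on would be true and would compute
the set. -/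
theorem exists_descent (hA : {n | ∃ x, P n x} ∉ M.sets) (s : M.Num) :
    ∃ k, s ≤ k ∧ stageValue P (k + 1) < stageValue P k := by
  by_contra hno
  push Not at hno
  refine hA (setOf_exists_mem_of_trueStages hP (U := fun k => s ≤ k)
    (IsBdd.le (.const s) (.var 0)).sig (fun a ha k hk => ?_) fun b => ?_)
  · have := bdd_induction (P := fun k => a ≤ k → ¬ stageValue P k < stageValue P a)
      (.imp (.le (.const a) (.var 0)) (.neg (isBdd_stageValue_lt hP (.var 0) (.const a)))) ?_ ?_ k
    · exact not_lt.1 (this hk.le)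
    · intro h
      rw [le_antisymm h (num_zero_le a)]
      exact lt_irrefl _
    · intro k ih h
      rcases h.lt_or_eq with h | rfl
      · have hak := num_lt_add_one_iff.1 h
        exact not_lt.2 ((not_lt.1 (ih hak)).trans (hno k (ha.trans hak)))
      · exact lt_irrefl _
  · exact ⟨b + s, le_self_add, le_add_self⟩

/-- The stages with a smaller value at the next stage are cofinal in the false stages. -/
theorem trueStage_iff (hA : {n | ∃ x, P n x} ∉ M.sets) (s : M.Num) :
    TrueStage (stageValue P) s ↔
      ¬ ∃ e, stageValue P (e + 1) < stageValue P e ∧ StageLE (stageValue P) s e := by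
  constructor
  · rintro hs ⟨e, he, h⟩
    rcases h with rfl | ⟨-, h⟩ | ⟨h, hF⟩
    · exact (hs _ (num_lt_add_one s)).not_gt he
    · exact hs.not_falseAt h
    · exact hF ⟨e + 1, num_lt_add_one e, num_add_one_le_iff.2 h, he⟩
  · intro h k hk
    by_contra hlt
    obtain ⟨e, hke, he⟩ := exists_descent hP hA k
    -- The drop at `e` comes at or after the stage `k` that exposes `s` as false, so `e` lies above
    -- `s`.
    exact h ⟨e, he, Or.inr (Or.inl ⟨hk.trans_le hke, k, hk, hke, not_le.1 hlt⟩)⟩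

omit hP in
-- Closedness is used only for singletons `{s}`. The set `E` of drops stands in for the set of all
-- false stages, which has only a `Σ⁰₁` definition, whereas `E` has a bounded one.
theorem FlatClosedForWellOrders.sigmaComprehension (hW : M.FlatClosedForWellOrders) :
    M.SigmaComprehension := by
  rintro A ⟨Q, hQ, hAQ⟩
  -- `Q` may mention further variables, but the equivalence holds for every assignment, so constant
  -- ones may be taken.
  have hP : M.IsBdd fun w => Q (fun _ => w 1) (w 0) := hQ.subst_cons (.var 0) fun _ => .var 1
  set P : M.Num → M.Num → Prop := fun n x => Q (fun _ => n) x
  have e : {n | A n} = {n | ∃ x, P n x} := Set.ext fun n => hAQ fun _ => n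
  rw [e]
  by_contra hA
  have hE : {e | stageValue P (e + 1) < stageValue P e} ∈ M.sets :=
    bdd_comprehension (isBdd_stageValue_lt hP (.add (.var 0) (.const 1)) (.var 0))
  obtain ⟨h, hh, -, hclosed⟩ := hW _ _ _ (isWellOrder_stageRel hP hA) hE (Set.subset_univ _)
  refine hA (setOf_exists_mem_of_trueStages hP (U := TrueStage (stageValue P)) ?_
    (fun _ => id) (exists_trueStage hP))
  -- This expresses that `{v 0}` lies in a basic open set listed by `h`. The bound `q < i` loses
  -- nothing, since elements are smaller than their code, and it keeps the matrix bounded.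
  have hS : M.IsSig fun v => ∃ n c i, M.pair n c ∈ h ∧ M.FinMem i c ∧
      ∀ q, q < i → M.FinMem q i → M.pair q (v 0) ∈ stageRel P :=
    .ex (.ex (.ex (IsBdd.and (.mem hh (.pair (.var 2) (.var 1))) (.and
      (isBdd_finMem (.var 0) (.var 1)) (.ball (.var 0) (.imp (isBdd_finMem (.var 0) (.var 1))
        (.mem (stageRel_mem hP) (.pair (.var 0) (.var 4))))))).sig))
  refine hS.congr fun v => ?_
  have hsingle : {x | x = v 0} ∈ M.sets := bdd_comprehension (.eq (.var 0) (.const _))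
  have hiff := hclosed _ hsingle (Set.subset_univ _)
  have hflat : M.FlatLE (stageRel P) {x | x = v 0} {e | stageValue P (e + 1) < stageValue P e} ↔
      ∃ e, stageValue P (e + 1) < stageValue P e ∧ StageLE (stageValue P) (v 0) e := by
    simp only [FlatLE, Set.mem_ofPred_eq, forall_eq, pair_mem_stageRel]
  rw [trueStage_iff hP hA, ← hflat, hiff]
  simp only [FlatInClosed, FlatInBasic, Set.mem_ofPred_eq, exists_eq_left]
  push Not
  refine exists_congr fun n => exists_congr fun c => ?_
  constructor
  · rintro ⟨i, hnc, hi, hq⟩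
    exact ⟨hnc, i, hi, fun q hqi => hq q hqi.lt hqi⟩
  · rintro ⟨hnc, i, hi, hq⟩
    exact ⟨i, hnc, hi, fun q _ hqi => hq q hqi⟩

end Reversal

end Model

end SecondOrderArith

/-- Over `RCA₀` the three statements are equivalent: they have the same truth value in every
model of `RCA₀`. -/
theorem proposition3p10 (M : SecondOrderArith.Model.{u}) (hM : M.IsRCA0) :
    List.TFAE [M.IsACA0, M.FlatClosedForQuasiOrders, M.FlatClosedForWellOrders] := by
  have : Fact M.IsRCA0 := ⟨hM⟩
  tfae_have 1 → 2 := fun h => h.sigmaComprehension.flatClosedForQuasiOrders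
  tfae_have 2 → 3 := fun h W R E hW => h W R E hW.toIsQuasiOrder
  tfae_have 3 → 1 := fun h => h.sigmaComprehension.isACA0
  tfae_finish
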